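/- **Setting.** Let $\mathcal G$ be the planar Galilean conformal algebra: the complex Lie algebra with basis $\{L_n,H_n,I_n,J_n\mid n\in\mathbb Z\}$ and brackets $$[L_m,L_n]=(n-m)L_{m+n},\quad [L_m,H_n]=nH_{m+n},\quad [L_m,I_n]=(n-m)I_{m+n},$$ $$[L_m,J_n]=(n-m)J_{m+n},\quad [H_m,I_n]=I_{m+n},\quad [H_m,J_n]=-J_{m+n},$$ all other brackets of basis elements (up to skew-symmetry) being zero. Put $\mathcal G_n=\mathbb C L_n\oplus\mathbb C H_n\oplus\mathbb C I_n\oplus\mathbb C J_n$. A $\mathcal G$-module $V$ is *restricted* if for every $v\in V$ there is $i\in\mathbb N$ with $\mathcal G_nv=0$ for all $n\ge i$. For $\lambda,\sigma\in\mathbb C^*$ and $\eta\in\mathbb C$ let $\Omega(\lambda,\sigma,\eta)=\mathbb C[s,t]$ and $\Gamma(\lambda,\sigma,\eta)=\mathbb C[x,y]$ be the $\mathcal G$-modules with actions $$L_nf(s,t)=\lambda^n(s-nt+n\eta)f(s-n,t),\quad H_nf(s,t)=\lambda^n t f(s-n,t),\quad I_nf(s,t)=\lambda^n\sigma f(s-n,t-1),\quad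 J_nf(s,t)=0,$$ $$L_ng(x,y)=\lambda^n(x+ny+n\eta)g(x-n,y),\quad H_ng(x,y)=\lambda^n y g(x-n,y),\quad I_ng(x,y)=0,\quad J_ng(x,y)=\lambda^n\sigma g(x-n,y+1).$$ For $\boldsymbol m=(m_1,m_2)\in\mathbb N^2$ (where $0\in\mathbb N$), $\boldsymbol\lambda,\boldsymbol\sigma\in(\mathbb C^*)^{m_1+m_2}$, $\boldsymbol\eta\in\mathbb C^{m_1+m_2}$ and a simple restricted $\mathcal G$-module $V$, define the tensor product $\mathcal G$-module $$\boldsymbol T(\boldsymbol m,\boldsymbol\lambda,\boldsymbol\sigma,\boldsymbol\eta,V)=\Big(\bigotimes_{k=1}^{m_1}\Omega(\lambda_k,\sigma_k,\eta_k)\Big)\otimes\Big(\bigotimes_{k=m_1+1}^{m_1+m_2}\Gamma(\lambda_k,\sigma_k,\eta_k)\Big)\otimes V .$$ **Theorem.** Let $V$ and $W$ be simple restricted $\mathcal G$-modules, and suppose that $\boldsymbol T(\boldsymbol m,\boldsymbol\lambda,\boldsymbol\sigma,\boldsymbol\eta,V)$ and $\boldsymbol T(\boldsymbol n,\boldsymbol\mu,\boldsymbol\tau,\boldsymbol\gamma,W)$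 are simple $\mathcal G$-modules, where $\boldsymbol n=(n_1,n_2)\in\mathbb N^2$, $\boldsymbol\mu,\boldsymbol\tau\in(\mathbb C^*)^{n_1+n_2}$ and $\boldsymbol\gamma\in\mathbb C^{n_1+n_2}$. Then $$\boldsymbol T(\boldsymbol m,\boldsymbol\lambda,\boldsymbol\sigma,\boldsymbol\eta,V)\cong\boldsymbol T(\boldsymbol n,\boldsymbol\mu,\boldsymbol\tau,\boldsymbol\gamma,W)$$ as $\mathcal G$-modules if and only if $\boldsymbol m=\boldsymbol n$, $V\cong W$ as $\mathcal G$-modules, and $$\{(\lambda_k,\sigma_k,\eta_k)\mid 1\le k\le m_1\}=\{(\mu_k,\tau_k,\gamma_k)\mid 1\le k\le n_1\},$$ $$\{(\lambda_k,\sigma_k,\eta_k)\mid m_1+1\le k\le m_1+m_2\}=\{(\mu_k,\tau_k,\gamma_k)\mid n_1+1\le k\le n_1+n_2\}.$$ -/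

import Mathlib

open scoped TensorProduct

/-! ### Tensor products of finite families of Lie modules -/

namespace PiTensorLie

variable {ι : Type*} [Fintype ι] [DecidableEq ι] {R L : Type*} [CommRing R] [LieRing L]
  [LieAlgebra R L] {M : ι → Type*} [∀ i, AddCommGroup (M i)] [∀ i, Module R (M i)]
  [∀ i, LieRingModule L (M i)] [∀ i, LieModule R L (M i)]

variable (R M) in
/-- The endomorphism `∑ i, 1 ⊗ ⋯ ⊗ x ⊗ ⋯ ⊗ 1` (with `x` in position `i`) of `⨂ i, M i`. -/
noncomputable def act (x : L) : Module.End R (⨂[R] i, M i) :=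
  ∑ i, PiTensorProduct.map
    (Function.update (fun j => (LinearMap.id : M j →ₗ[R] M j)) i (LieModule.toEnd R L (M i) x))

theorem act_tprod (x : L) (m : ∀ i, M i) :
    act R M x (PiTensorProduct.tprod R m) =
      ∑ i, PiTensorProduct.tprod R (Function.update m i ⁅x, m i⁆) := by
  simp only [act, LinearMap.sum_apply, PiTensorProduct.map_tprod]
  refine Finset.sum_congr rfl fun i _ => ?_
  congr 1
  funext j
  by_cases h : j = i
  · subst h; simp
  · simp [h]

theorem act_add (x y : L) : act R M (x + y) = act R M x + act R M y := by
  simp only [act, map_add, PiTensorProduct.map_update_add, Finset.sum_add_distrib]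

theorem act_smul (c : R) (x : L) : act R M (c • x) = c • act R M x := by
  simp only [act, map_smul, PiTensorProduct.map_update_smul, Finset.smul_sum]

theorem act_lie (x y : L) :
    act R M x * act R M y = act R M ⁅x, y⁆ + act R M y * act R M x := by
  ext m
  simp only [LinearMap.compMultilinearMap_apply, Module.End.mul_apply, LinearMap.add_apply,
    act_tprod, map_sum]
  have key : ∀ i j, j ≠ i → ∀ (u v : L),
      PiTensorProduct.tprod R (Function.update (Function.update m i ⁅v, m i⁆) j
        ⁅u, Function.update m i ⁅v, m i⁆ j⁆) =
      PiTensorProduct.tprod R (Function.update (Function.update m j ⁅u, m j⁆) i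
        ⁅v, Function.update m j ⁅u, m j⁆ i⁆) := by
    intro i j h u v
    rw [Function.update_of_ne h, Function.update_of_ne h.symm, Function.update_comm h]
  have split : ∀ (u v : L), ∑ i, ∑ j,
      PiTensorProduct.tprod R (Function.update (Function.update m i ⁅v, m i⁆) j
        ⁅u, Function.update m i ⁅v, m i⁆ j⁆) =
      ∑ i, PiTensorProduct.tprod R (Function.update m i ⁅u, ⁅v, m i⁆⁆) +
      ∑ i, ∑ j ∈ Finset.univ.erase i,
        PiTensorProduct.tprod R (Function.update (Function.update m i ⁅v, m i⁆) j
          ⁅u, Function.update m i ⁅v, m i⁆ j⁆) := by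
    intro u v
    rw [← Finset.sum_add_distrib]
    refine Finset.sum_congr rfl fun i _ => ?_
    rw [← Finset.add_sum_erase _ _ (Finset.mem_univ i)]
    simp
  have diag : ∑ i, PiTensorProduct.tprod R (Function.update m i ⁅x, ⁅y, m i⁆⁆) =
      ∑ i, PiTensorProduct.tprod R (Function.update m i ⁅⁅x, y⁆, m i⁆) +
      ∑ i, PiTensorProduct.tprod R (Function.update m i ⁅y, ⁅x, m i⁆⁆) := by
    rw [← Finset.sum_add_distrib]
    refine Finset.sum_congr rfl fun i _ => ?_
    rw [leibniz_lie x y (m i), MultilinearMap.map_update_add]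
  rw [split x y, split y x, ← add_assoc, ← diag]
  congr 1
  rw [Finset.sum_comm' (t' := Finset.univ) (s' := fun j => Finset.univ.erase j)
    (by intro a b; simp [eq_comm])]
  refine Finset.sum_congr rfl fun i _ => Finset.sum_congr rfl fun j hj => ?_
  exact key _ _ (Finset.ne_of_mem_erase hj).symm _ _

noncomputable instance : LieRingModule L (⨂[R] i, M i) where
  bracket x := act R M x
  add_lie x y t := by
    change act R M (x + y) t = act R M x t + act R M y t
    rw [act_add]; rfl
  lie_add x := map_add (act R M x)
  leibniz_lie x y t := LinearMap.congr_fun (act_lie (R := R) (M := M) x y) t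

instance : LieModule R L (⨂[R] i, M i) where
  smul_lie c x t := by
    change act R M (c • x) t = c • act R M x t
    rw [act_smul]; rfl
  lie_smul c x := map_smul (act R M x) c

theorem lie_tprod (x : L) (m : ∀ i, M i) :
    ⁅x, PiTensorProduct.tprod R m⁆ =
      ∑ i, PiTensorProduct.tprod R (Function.update m i ⁅x, m i⁆) :=
  act_tprod x m

end PiTensorLie

/-! ### The planar Galilean conformal algebra -/

namespace PGCA

/-- Labels of the basis vectors `L_n, H_n, I_n, J_n` (`n ∈ ℤ`). -/
inductive Idx : Type
  | L (n : ℤ) : Idx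
  | H (n : ℤ) : Idx
  | I (n : ℤ) : Idx
  | J (n : ℤ) : Idx

/-- The underlying complex vector space, with basis `L_n, H_n, I_n, J_n`. -/
def Alg : Type := Idx →₀ ℂ

noncomputable instance : AddCommGroup Alg := inferInstanceAs (AddCommGroup (Idx →₀ ℂ))
noncomputable instance : Module ℂ Alg := inferInstanceAs (Module ℂ (Idx →₀ ℂ))

/-- The standard basis. -/
noncomputable def basis : Module.Basis Idx ℂ Alg :=
  (Finsupp.basisSingleOne : Module.Basis Idx ℂ (Idx →₀ ℂ))

noncomputable abbrev L (n : ℤ) : Alg := basis (Idx.L n)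
noncomputable abbrev H (n : ℤ) : Alg := basis (Idx.H n)
noncomputable abbrev I (n : ℤ) : Alg := basis (Idx.I n)
noncomputable abbrev J (n : ℤ) : Alg := basis (Idx.J n)

/-- The brackets of the basis vectors. -/
noncomputable def basisBracket : Idx → Idx → Alg
  | .L m, .L n => ((n : ℂ) - m) • L (m + n)
  | .L m, .H n => (n : ℂ) • H (m + n)
  | .L m, .I n => ((n : ℂ) - m) • I (m + n)
  | .L m, .J n => ((n : ℂ) - m) • J (m + n)
  | .H m, .L n => -((m : ℂ) • H (m + n))
  | .H _, .H _ => 0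
  | .H m, .I n => I (m + n)
  | .H m, .J n => -J (m + n)
  | .I m, .L n => -(((m : ℂ) - n) • I (m + n))
  | .I m, .H n => -I (m + n)
  | .I _, .I _ => 0
  | .I _, .J _ => 0
  | .J m, .L n => -(((m : ℂ) - n) • J (m + n))
  | .J m, .H n => J (m + n)
  | .J _, .I _ => 0
  | .J _, .J _ => 0

/-- The bilinear extension of `basisBracket`. -/
noncomputable def bracketMap : Alg →ₗ[ℂ] Alg →ₗ[ℂ] Alg :=
  basis.constr ℂ fun a => basis.constr ℂ fun b => basisBracket a b

theorem bracketMap_basis (a b : Idx) : bracketMap (basis a) (basis b) = basisBracket a b := by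
  simp [bracketMap]

theorem basis_induction {p : Alg → Prop} (zero : p 0) (add : ∀ x y, p x → p y → p (x + y))
    (smul : ∀ (c : ℂ) x, p x → p (c • x)) (single : ∀ a, p (basis a)) (x : Alg) : p x := by
  have hx : x ∈ Submodule.span ℂ (Set.range basis) := by rw [basis.span_eq]; trivial
  induction hx using Submodule.span_induction with
  | mem y hy => obtain ⟨a, rfl⟩ := hy; exact single a
  | zero => exact zero
  | add y z _ _ hy hz => exact add y z hy hz
  | smul c y _ hy => exact smul c y hy

theorem bracketMap_skew : bracketMap = -bracketMap.flip := by
  refine basis.ext fun a => basis.ext fun b => ?_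
  simp only [LinearMap.neg_apply, LinearMap.flip_apply, bracketMap_basis]
  rcases a with m | m | m | m <;> rcases b with n | n | n | n <;>
    simp only [basisBracket, add_comm n m, neg_neg, neg_zero, ← neg_smul, neg_sub]

theorem bracketMap_leibniz (a b c : Idx) :
    bracketMap (basis a) (bracketMap (basis b) (basis c)) =
      bracketMap (bracketMap (basis a) (basis b)) (basis c) +
        bracketMap (basis b) (bracketMap (basis a) (basis c)) := by
  simp only [bracketMap_basis]
  rcases a with m | m | m | m <;> rcases b with n | n | n | n <;> rcases c with k | k | k | k <;>
    simp only [basisBracket, map_smul, map_neg, map_zero, LinearMap.smul_apply,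
      LinearMap.neg_apply, LinearMap.zero_apply, bracketMap_basis, smul_zero, neg_zero,
      add_zero, zero_add, smul_neg, neg_neg] <;>
    simp only [← add_assoc, add_comm n m] <;>
    push_cast <;> module

noncomputable instance : LieRing Alg where
  bracket x y := bracketMap x y
  add_lie x y z := by
    change bracketMap (x + y) z = _
    rw [map_add]; rfl
  lie_add x := map_add (bracketMap x)
  lie_self x := by
    have h : bracketMap x x = -bracketMap x x := by
      conv_lhs => rw [bracketMap_skew]
      rfl
    have h2 : (2 : ℂ) • bracketMap x x = 0 := by
      rw [two_smul]; exact add_eq_zero_iff_eq_neg.mpr h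
    exact (smul_eq_zero.mp h2).resolve_left two_ne_zero
  leibniz_lie x y z := by
    change bracketMap x (bracketMap y z) =
      bracketMap (bracketMap x y) z + bracketMap y (bracketMap x z)
    induction x using basis_induction with
    | zero => simp
    | add x x' hx hx' => simp only [map_add, LinearMap.add_apply, hx, hx']; abel
    | smul c x hx => simp only [map_smul, LinearMap.smul_apply, hx, smul_add]
    | single a =>
      induction y using basis_induction with
      | zero => simp
      | add y y' hy hy' => simp only [map_add, LinearMap.add_apply, hy, hy']; abel
      | smul c y hy => simp only [map_smul, LinearMap.smul_apply, hy, smul_add]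
      | single b =>
        induction z using basis_induction with
        | zero => simp
        | add z z' hz hz' => simp only [map_add, hz, hz']; abel
        | smul c z hz => simp only [map_smul, hz, smul_add]
        | single c => exact bracketMap_leibniz a b c

noncomputable instance : LieAlgebra ℂ Alg where
  lie_smul c x := map_smul (bracketMap x) c

theorem lie_basis (a b : Idx) : ⁅basis a, basis b⁆ = basisBracket a b := bracketMap_basis a b

/-- The homogeneous component of degree `n`. -/
noncomputable def grade (n : ℤ) : Submodule ℂ Alg := Submodule.span ℂ {L n, H n, I n, J n}

/-- A module `V` is restricted if every `v : V` is annihilated by all components of large degree. -/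
def IsRestricted (V : Type*) [AddCommGroup V] [LieRingModule Alg V] : Prop :=
  ∀ v : V, ∃ i : ℕ, ∀ n : ℤ, (i : ℤ) ≤ n → ∀ x ∈ grade n, ⁅x, v⁆ = 0

/-! ### Modules from operators attached to the basis vectors -/

section FromBasis

variable {P : Type*} [AddCommGroup P] [Module ℂ P]

/-- The linear extension of a family of operators `op a` indexed by the basis. -/
noncomputable def extend (op : Idx → Module.End ℂ P) : Alg →ₗ[ℂ] Module.End ℂ P :=
  basis.constr ℂ op

theorem extend_basis (op : Idx → Module.End ℂ P) (a : Idx) : extend op (basis a) = op a := by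
  simp [extend]

theorem extend_lie (op : Idx → Module.End ℂ P)
    (h : ∀ a b, op a * op b = extend op (basisBracket a b) + op b * op a) (x y : Alg) :
    extend op x * extend op y = extend op ⁅x, y⁆ + extend op y * extend op x := by
  induction x using basis_induction with
  | zero => simp
  | add x x' hx hx' => simp only [map_add, add_lie, add_mul, mul_add, hx, hx']; abel
  | smul c x hx => simp only [map_smul, smul_lie, smul_mul_assoc, mul_smul_comm, hx, smul_add]
  | single a =>
    induction y using basis_induction with
    | zero => simp
    | add y y' hy hy' => simp only [map_add, lie_add, add_mul, mul_add, hy, hy']; abel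
    | smul c y hy => simp only [map_smul, lie_smul, smul_mul_assoc, mul_smul_comm, hy, smul_add]
    | single b => rw [extend_basis, extend_basis, lie_basis, h]

end FromBasis

/-! ### The modules `Ω(lam, sig, eta)` and `Γ(lam, sig, eta)` -/

open MvPolynomial

/-- The substitution `f(X₀, X₁) ↦ f(X₀ - a, X₁ - b)`. -/
noncomputable def shift (a b : ℂ) : MvPolynomial (Fin 2) ℂ →ₐ[ℂ] MvPolynomial (Fin 2) ℂ :=
  aeval ![X 0 - C a, X 1 - C b]

theorem shift_X0 (a b : ℂ) : shift a b (X 0) = X 0 - C a := by simp [shift]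

theorem shift_X1 (a b : ℂ) : shift a b (X 1) = X 1 - C b := by simp [shift]

theorem shift_C (a b c : ℂ) : shift a b (C c) = C c := by simp [shift]

theorem shift_shift (a b c d : ℂ) (f : MvPolynomial (Fin 2) ℂ) :
    shift a b (shift c d f) = shift (a + c) (b + d) f := by
  have : (shift a b).comp (shift c d) = shift (a + c) (b + d) := by
    ext i : 1
    fin_cases i
    · simp [shift]; ring
    · simp [shift]; ring
  exact DFunLike.congr_fun this f

/-- The operator `f(X₀, X₁) ↦ p · f(X₀ - a, X₁ - b)`. -/
noncomputable def mulShift (p : MvPolynomial (Fin 2) ℂ) (a b : ℂ) :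
    Module.End ℂ (MvPolynomial (Fin 2) ℂ) :=
  LinearMap.mulLeft ℂ p ∘ₗ (shift a b).toLinearMap

theorem mulShift_apply (p : MvPolynomial (Fin 2) ℂ) (a b : ℂ) (f : MvPolynomial (Fin 2) ℂ) :
    mulShift p a b f = p * shift a b f := rfl

/-- The operators by which the basis vectors act on `Ω(lam, sig, eta) = ℂ[s, t]`,
with `s = X 0` and `t = X 1`. -/
noncomputable def omegaOp (lam sig : ℂˣ) (eta : ℂ) : Idx → Module.End ℂ (MvPolynomial (Fin 2) ℂ)
  | .L n => ((lam ^ n : ℂˣ) : ℂ) • mulShift (X 0 - C (n : ℂ) * X 1 + C (n * eta)) n 0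
  | .H n => ((lam ^ n : ℂˣ) : ℂ) • mulShift (X 1) n 0
  | .I n => ((lam ^ n : ℂˣ) : ℂ) • mulShift (C (sig : ℂ)) n 1
  | .J _ => 0

/-- The operators by which the basis vectors act on `Γ(lam, sig, eta) = ℂ[x, y]`,
with `x = X 0` and `y = X 1`. -/
noncomputable def gammaOp (lam sig : ℂˣ) (eta : ℂ) : Idx → Module.End ℂ (MvPolynomial (Fin 2) ℂ)
  | .L n => ((lam ^ n : ℂˣ) : ℂ) • mulShift (X 0 + C (n : ℂ) * X 1 + C (n * eta)) n 0
  | .H n => ((lam ^ n : ℂˣ) : ℂ) • mulShift (X 1) n 0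
  | .I _ => 0
  | .J n => ((lam ^ n : ℂˣ) : ℂ) • mulShift (C (sig : ℂ)) n (-1)

theorem omegaOp_lie (lam sig : ℂˣ) (eta : ℂ) (a b : Idx) :
    omegaOp lam sig eta a * omegaOp lam sig eta b =
      extend (omegaOp lam sig eta) (basisBracket a b) +
        omegaOp lam sig eta b * omegaOp lam sig eta a := by
  rcases a with m | m | m | m <;> rcases b with n | n | n | n <;>
    refine LinearMap.ext fun f => ?_ <;>
    simp only [basisBracket, map_smul, map_neg, map_zero, extend_basis, omegaOp,
      Module.End.mul_apply, LinearMap.add_apply, LinearMap.smul_apply, LinearMap.neg_apply,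
      LinearMap.zero_apply, mulShift_apply, map_mul, map_add, map_sub, shift_X0, shift_X1,
      shift_C, shift_shift, zpow_add, Units.val_mul, smul_zero, neg_zero, add_zero, zero_add,
      mul_zero, MvPolynomial.smul_eq_C_mul, Int.cast_add, add_comm (n : ℂ) (m : ℂ),
      C_1, sub_zero] <;>
    ring

theorem gammaOp_lie (lam sig : ℂˣ) (eta : ℂ) (a b : Idx) :
    gammaOp lam sig eta a * gammaOp lam sig eta b =
      extend (gammaOp lam sig eta) (basisBracket a b) +
        gammaOp lam sig eta b * gammaOp lam sig eta a := by
  rcases a with m | m | m | m <;> rcases b with n | n | n | n <;>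
    refine LinearMap.ext fun f => ?_ <;>
    simp only [basisBracket, map_smul, map_neg, map_zero, extend_basis, gammaOp,
      Module.End.mul_apply, LinearMap.add_apply, LinearMap.smul_apply, LinearMap.neg_apply,
      LinearMap.zero_apply, mulShift_apply, map_mul, map_add, map_sub, shift_X0, shift_X1,
      shift_C, shift_shift, zpow_add, Units.val_mul, smul_zero, neg_zero, add_zero, zero_add,
      mul_zero, MvPolynomial.smul_eq_C_mul, Int.cast_add, add_comm (n : ℂ) (m : ℂ),
      C_1, sub_zero] <;>
    ring

/-- The module `Ω(lam, sig, eta)`, with underlying space `ℂ[s, t]`. -/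
@[nolint unusedArguments]
def Omega (_lam _sig : ℂˣ) (_eta : ℂ) : Type := MvPolynomial (Fin 2) ℂ

/-- The module `Γ(lam, sig, eta)`, with underlying space `ℂ[x, y]`. -/
@[nolint unusedArguments]
def Gamma (_lam _sig : ℂˣ) (_eta : ℂ) : Type := MvPolynomial (Fin 2) ℂ

section Instances

variable (lam sig : ℂˣ) (eta : ℂ)

noncomputable instance : AddCommGroup (Omega lam sig eta) :=
  inferInstanceAs (AddCommGroup (MvPolynomial (Fin 2) ℂ))

noncomputable instance : Module ℂ (Omega lam sig eta) :=
  inferInstanceAs (Module ℂ (MvPolynomial (Fin 2) ℂ))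

noncomputable instance : AddCommGroup (Gamma lam sig eta) :=
  inferInstanceAs (AddCommGroup (MvPolynomial (Fin 2) ℂ))

noncomputable instance : Module ℂ (Gamma lam sig eta) :=
  inferInstanceAs (Module ℂ (MvPolynomial (Fin 2) ℂ))

/-- The linear action map of `Ω(lam, sig, eta)`. -/
noncomputable def Omega.act : Alg →ₗ[ℂ] Module.End ℂ (Omega lam sig eta) :=
  extend (P := MvPolynomial (Fin 2) ℂ) (omegaOp lam sig eta)

/-- The linear action map of `Γ(lam, sig, eta)`. -/
noncomputable def Gamma.act : Alg →ₗ[ℂ] Module.End ℂ (Gamma lam sig eta) :=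
  extend (P := MvPolynomial (Fin 2) ℂ) (gammaOp lam sig eta)

noncomputable instance : LieRingModule Alg (Omega lam sig eta) where
  bracket x f := Omega.act lam sig eta x f
  add_lie x y f := by
    change Omega.act lam sig eta (x + y) f = _
    rw [map_add]; rfl
  lie_add x := map_add (Omega.act lam sig eta x)
  leibniz_lie x y f := LinearMap.congr_fun
    (extend_lie (omegaOp lam sig eta) (omegaOp_lie lam sig eta) x y) f

instance : LieModule ℂ Alg (Omega lam sig eta) where
  smul_lie c x f := by
    change Omega.act lam sig eta (c • x) f = _
    rw [map_smul]; rfl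
  lie_smul c x := map_smul (Omega.act lam sig eta x) c

noncomputable instance : LieRingModule Alg (Gamma lam sig eta) where
  bracket x f := Gamma.act lam sig eta x f
  add_lie x y f := by
    change Gamma.act lam sig eta (x + y) f = _
    rw [map_add]; rfl
  lie_add x := map_add (Gamma.act lam sig eta x)
  leibniz_lie x y f := LinearMap.congr_fun
    (extend_lie (gammaOp lam sig eta) (gammaOp_lie lam sig eta) x y) f

instance : LieModule ℂ Alg (Gamma lam sig eta) where
  smul_lie c x f := by
    change Gamma.act lam sig eta (c • x) f = _
    rw [map_smul]; rfl
  lie_smul c x := map_smul (Gamma.act lam sig eta x) c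

theorem Omega.lie_basis (a : Idx) (f : Omega lam sig eta) :
    ⁅basis a, f⁆ = omegaOp lam sig eta a f :=
  LinearMap.congr_fun (extend_basis (omegaOp lam sig eta) a) f

theorem Gamma.lie_basis (a : Idx) (f : Gamma lam sig eta) :
    ⁅basis a, f⁆ = gammaOp lam sig eta a f :=
  LinearMap.congr_fun (extend_basis (gammaOp lam sig eta) a) f

end Instances

/-- The tensor product module `T((m₁, m₂), lam, sig, eta, V)`: the first `m₁` parameters give the
`Ω`-factors, the last `m₂` parameters the `Γ`-factors. -/
abbrev T (m₁ m₂ : ℕ) (lam sig : Fin (m₁ + m₂) → ℂˣ) (eta : Fin (m₁ + m₂) → ℂ)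
    (V : Type*) [AddCommGroup V] [Module ℂ V] : Type _ :=
  ((⨂[ℂ] k : Fin m₁, Omega (lam (Fin.castAdd m₂ k)) (sig (Fin.castAdd m₂ k))
      (eta (Fin.castAdd m₂ k))) ⊗[ℂ]
    (⨂[ℂ] k : Fin m₂, Gamma (lam (Fin.natAdd m₁ k)) (sig (Fin.natAdd m₁ k))
      (eta (Fin.natAdd m₁ k)))) ⊗[ℂ] V

/-- The set of triples `(lam_k, sig_k, eta_k)` attached to the `Ω`-factors. -/
def omegaParams (m₁ m₂ : ℕ) (lam sig : Fin (m₁ + m₂) → ℂˣ) (eta : Fin (m₁ + m₂) → ℂ) :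
    Set (ℂˣ × ℂˣ × ℂ) :=
  Set.range fun k : Fin m₁ =>
    (lam (Fin.castAdd m₂ k), sig (Fin.castAdd m₂ k), eta (Fin.castAdd m₂ k))

/-- The set of triples `(lam_k, sig_k, eta_k)` attached to the `Γ`-factors. -/
def gammaParams (m₁ m₂ : ℕ) (lam sig : Fin (m₁ + m₂) → ℂˣ) (eta : Fin (m₁ + m₂) → ℂ) :
    Set (ℂˣ × ℂˣ × ℂ) :=
  Set.range fun k : Fin m₂ =>
    (lam (Fin.natAdd m₁ k), sig (Fin.natAdd m₁ k), eta (Fin.natAdd m₁ k))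

end PGCA

/-! ### Sequences and generalized eigenspaces of the shift -/

namespace PGCA

open MvPolynomial Module.End Filter

section Sequences

variable {M M' : Type*} [AddCommGroup M] [Module ℂ M] [AddCommGroup M'] [Module ℂ M']

/-! Multiplying the polynomial factors identifies each tensor product with `Poly K ⊗ V`, two
variables per factor. There the degree `n` vector of a given type acts on the factor `k` by `λ_k ^ n
• (A + n • B)` composed with the `n`-th power of a translation, with `A` and `B` independent of `n`
(`factorT_apply`). Translations of polynomials are locally unipotent, so for a fixed vector this is
an exponential polynomial in `n` with base `λ_k`. Restrictedness removes the contribution of `V` for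
large `n`.

Simplicity forces the `λ_k` to be pairwise distinct: otherwise the vectors on which two translations
agree form a proper nonzero submodule (`lam_injective_of_invariant`).

Given an isomorphism `Φ`, independence of exponential polynomials
(`eq_zero_of_eventually_sum_eq_zero`) separates the bases, so `Φ` carries the action on one factor
to the action on the factor with the same `λ`, in every degree `n ≥ 0` (`sum_factorT_eq`). Degrees 0
and 1 already give the type, `σ` and `η` (`Intertwines.param_eq`), and show that `Φ (1 ⊗ v)` is
invariant under a unit translation, up to sign, in every variable. Hence `Φ (1 ⊗ v) = 1 ⊗ ψ v`;
cancelling the factor contributions makes `ψ` equivariant, and simplicity of `W` makes it an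
isomorphism (`exists_equiv_of_iso`).

Conversely, since the `λ_k` are distinct, equal parameter sets give a bijection of the factors, and
renaming variables along it yields an isomorphism (`exists_iso_of_equiv`). -/

theorem mem_maxGenEigenspace_of_sub_smul_mem {f : Module.End ℂ M} {z : ℂ} {m : M}
    (h : f m - z • m ∈ f.maxGenEigenspace z) : m ∈ f.maxGenEigenspace z := by
  rw [mem_maxGenEigenspace] at h ⊢
  obtain ⟨k, hk⟩ := h
  refine ⟨k + 1, ?_⟩
  rw [pow_succ, Module.End.mul_apply]
  simpa using hk

/-- An operator whose commutator with `f` preserves a maximal generalized eigenspace of `f`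
preserves that eigenspace. -/
theorem map_mem_maxGenEigenspace_of_commutator {f B D : Module.End ℂ M} {z : ℂ}
    (hc : ∀ m, f (B m) = B (f m) + D m)
    (hD : ∀ m ∈ f.maxGenEigenspace z, D m ∈ f.maxGenEigenspace z) {m : M}
    (hm : m ∈ f.maxGenEigenspace z) : B m ∈ f.maxGenEigenspace z := by
  have key : ∀ (k : ℕ) (m : M), ((f - z • 1) ^ k) m = 0 → B m ∈ f.maxGenEigenspace z := by
    intro k
    induction k with
    | zero => intro m h; simp_all
    | succ k ih =>
      intro m h
      apply mem_maxGenEigenspace_of_sub_smul_mem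
      rw [hc, add_sub_right_comm, ← map_smul, ← map_sub]
      refine Submodule.add_mem _ (ih _ ?_) (hD _ ((mem_maxGenEigenspace _ _ _).2 ⟨_, h⟩))
      rw [pow_succ, Module.End.mul_apply] at h
      simpa using h
  obtain ⟨k, hk⟩ := (mem_maxGenEigenspace _ _ _).1 hm
  exact key k m hk

/-- The hypothesis gives `(g - yz) F = y F (f - z)`, so powers of `f - z` killing `m` yield powers
of `g - yz` killing `F m`. -/
theorem map_mem_maxGenEigenspace {f : Module.End ℂ M} {g : Module.End ℂ M'} {z y : ℂ}
    (F : M →ₗ[ℂ] M') (hF : ∀ m, g (F m) = y • F (f m)) {m : M}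
    (hm : m ∈ f.maxGenEigenspace z) : F m ∈ g.maxGenEigenspace (y * z) := by
  have key : ∀ (k : ℕ) (m : M), ((f - z • 1) ^ k) m = 0 → F m ∈ g.maxGenEigenspace (y * z) := by
    intro k
    induction k with
    | zero => intro m h; simp_all
    | succ k ih =>
      intro m h
      apply mem_maxGenEigenspace_of_sub_smul_mem
      have h2 : F (f m - z • m) ∈ g.maxGenEigenspace (y * z) := by
        apply ih
        rw [pow_succ, Module.End.mul_apply] at h
        simpa using h
      rw [hF, mul_smul, ← smul_sub, ← map_smul, ← map_sub]
      exact Submodule.smul_mem _ _ h2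
  obtain ⟨k, hk⟩ := (mem_maxGenEigenspace _ _ _).1 hm
  exact key k m hk

variable (M) in
/-- The shift of sequences, `(seqShift f) n = f (n + 1)`. -/
def seqShift : Module.End ℂ (ℕ → M) := LinearMap.funLeft ℂ M (· + 1)

theorem seqShift_apply (f : ℕ → M) (n : ℕ) : seqShift M f n = f (n + 1) := rfl

theorem seqShift_pow_apply (k : ℕ) (f : ℕ → M) (n : ℕ) : (seqShift M ^ k) f n = f (n + k) := by
  induction k generalizing f with
  | zero => simp
  | succ k ih => rw [pow_succ, Module.End.mul_apply, ih, seqShift_apply, add_assoc]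

/-- The commutator of the shift with multiplication by `n` is the shift itself, which preserves its
own generalized eigenspaces. -/
theorem natCast_smul_mem_maxGenEigenspace {f : ℕ → M} {z : ℂ}
    (hf : f ∈ (seqShift M).maxGenEigenspace z) :
    (fun n : ℕ => (n : ℂ) • f n) ∈ (seqShift M).maxGenEigenspace z := by
  let B : Module.End ℂ (ℕ → M) :=
    { toFun := fun f n => (n : ℂ) • f n
      map_add' := by intro f g; ext n; simp
      map_smul' := fun a f => funext fun n => smul_comm (n : ℂ) a (f n) }
  refine map_mem_maxGenEigenspace_of_commutator (B := B) (D := seqShift M) ?_ ?_ hf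
  · intro f
    ext n
    simp [B, seqShift_apply, add_smul]
  · intro m hm
    exact Module.End.mapsTo_maxGenEigenspace_of_comm (Commute.refl _) _ hm

theorem mem_maxGenEigenspace_zero_of_eventually {f : ℕ → M} (hf : ∀ᶠ n in atTop, f n = 0) :
    f ∈ (seqShift M).maxGenEigenspace 0 := by
  obtain ⟨N, hN⟩ := eventually_atTop.1 hf
  refine (mem_maxGenEigenspace _ _ _).2 ⟨N, ?_⟩
  ext n
  simpa [seqShift_pow_apply] using hN (n + N) (by omega)

/-- Linear independence of exponential polynomials, for sequences considered up to finitely many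
terms. -/
theorem eq_zero_of_eventually_sum_eq_zero (S : Finset ℂ) (hS : (0 : ℂ) ∉ S) (f : ℂ → ℕ → M)
    (hf : ∀ z ∈ S, f z ∈ (seqShift M).maxGenEigenspace z)
    (h : ∀ᶠ n in atTop, ∑ z ∈ S, f z n = 0) : ∀ z ∈ S, f z = 0 := by
  classical
  have hind := (seqShift M).independent_maxGenEigenspace
  rw [iSupIndep_iff_finsetSum_eq_zero_imp_eq_zero] at hind
  -- The total sum is eventually zero, hence lies in the generalized eigenspace of the shift for 0.
  -- Its negative, placed at the unused index 0, turns the eventual relation into an exact one.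
  let g : ℂ → ℕ → M := fun z => if z = 0 then -∑ z ∈ S, f z else f z
  have hg : ∀ z ∈ S, g z = f z := fun z hz => if_neg (by rintro rfl; exact hS hz)
  intro z hz
  rw [← hg z hz]
  refine hind (insert 0 S) g ?_ ?_ z (Finset.mem_insert_of_mem hz)
  · intro z hz
    rcases Finset.mem_insert.1 hz with rfl | hz
    · simp only [g, if_true]
      refine Submodule.neg_mem _ (mem_maxGenEigenspace_zero_of_eventually ?_)
      simpa using h
    · rw [hg z hz]; exact hf z hz
  · rw [Finset.sum_insert hS, Finset.sum_congr rfl hg]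
    simp [g]

end Sequences

/-! ### Translations of polynomials -/

section Translate

variable {σ : Type*}

/-- The substitution `X i ↦ X i - c i`. -/
noncomputable def translate (c : σ → ℂ) : MvPolynomial σ ℂ →ₐ[ℂ] MvPolynomial σ ℂ :=
  aeval fun i => X i - C (c i)

@[simp] theorem translate_X (c : σ → ℂ) (i : σ) : translate c (X i) = X i - C (c i) := by
  simp [translate]

@[simp] theorem translate_C (c : σ → ℂ) (a : ℂ) : translate c (C a) = C a := by
  simp [translate]

theorem translate_translate (c d : σ → ℂ) (p : MvPolynomial σ ℂ) :
    translate c (translate d p) = translate (c + d) p := by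
  have : (translate c).comp (translate d) = translate (c + d) := by
    ext i : 1
    simp [sub_sub]
  exact DFunLike.congr_fun this p

@[simp] theorem translate_zero (p : MvPolynomial σ ℂ) : translate 0 p = p := by
  have : translate (0 : σ → ℂ) = AlgHom.id ℂ _ := by
    ext i : 1
    simp
  exact DFunLike.congr_fun this p

theorem eval_translate (c x : σ → ℂ) (p : MvPolynomial σ ℂ) :
    eval x (translate c p) = eval (x - c) p := by
  induction p using MvPolynomial.induction_on with
  | C a => simp
  | add p q hp hq => simp [hp, hq]
  | mul_X p i hp => simp [hp]

/-- Constants are fixed, and the commutator of the translation with multiplication by `X i` is a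
multiple of the translation, so the eigenspace is stable under each `X i`. -/
theorem mem_maxGenEigenspace_translate (c : σ → ℂ) (p : MvPolynomial σ ℂ) :
    p ∈ maxGenEigenspace (translate c).toLinearMap 1 := by
  induction p using MvPolynomial.induction_on with
  | C a =>
    apply mem_maxGenEigenspace_of_sub_smul_mem
    simp
  | add p q hp hq => exact Submodule.add_mem _ hp hq
  | mul_X p i hp =>
    rw [mul_comm]
    refine map_mem_maxGenEigenspace_of_commutator (B := LinearMap.mulLeft ℂ (X i))
      (D := -(c i • (translate c).toLinearMap)) ?_ ?_ hp
    · intro q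
      simp [MvPolynomial.smul_eq_C_mul]
      ring
    · intro m hm
      exact Submodule.neg_mem _ (Submodule.smul_mem _ _
        (Module.End.mapsTo_maxGenEigenspace_of_comm (Commute.refl _) _ hm))

/-- A polynomial that is invariant under a translation by `±1` in each coordinate is constant. -/
theorem eq_C_of_translate_eq [Finite σ] [DecidableEq σ] {b : σ → ℂ}
    (hb : ∀ i, b i = 1 ∨ b i = -1) {p : MvPolynomial σ ℂ}
    (h : ∀ i, translate (Pi.single i (b i)) p = p) : p = C (eval 0 p) := by
  have := Fintype.ofFinite σ
  have neg : ∀ c : σ → ℂ, translate c p = p → translate (-c) p = p := by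
    intro c hc
    conv_lhs => rw [← hc]
    simp [translate_translate]
  -- The periods of `p` form a monoid containing every `-e_i`, hence every `-x` with `x` in `ℕ^σ`.
  -- Therefore `p x = p 0` on `ℕ^σ`, a product of infinite sets, which determines `p`.
  let G : AddSubmonoid (σ → ℂ) :=
    { carrier := {c | translate c p = p}
      zero_mem' := translate_zero p
      add_mem' := by
        intro c d hc hd
        change translate (c + d) p = p
        rw [← translate_translate, hd, hc] }
  have hG : ∀ i, Pi.single i (-1 : ℂ) ∈ G := by
    intro i
    have h1 := h i
    rcases hb i with hi | hi <;> rw [hi] at h1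
    · rw [Pi.single_neg]; exact neg _ h1
    · exact h1
  refine MvPolynomial.funext_set (fun _ : σ => Set.range (Nat.cast : ℕ → ℂ))
    (fun _ => Set.infinite_range_of_injective Nat.cast_injective) fun x hx => ?_
  choose n hn using fun i => hx i trivial
  have hmem : -x ∈ G := by
    have : -x = ∑ i, n i • (Pi.single i (-1 : ℂ) : σ → ℂ) := by
      ext j
      simp [Finset.sum_apply, Pi.single_apply, hn]
    rw [this]
    exact AddSubmonoid.sum_mem _ fun i _ => AddSubmonoid.nsmul_mem _ (hG i) _
  have h2 : translate (-x) p = p := hmem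
  have h3 := eval_translate (-x) 0 p
  rw [h2] at h3
  simpa using h3.symm

end Translate

/-! ### Translations on polynomials with coefficients in a vector space -/

section TranslateTensor

variable {σ : Type*} {V : Type*} [AddCommGroup V] [Module ℂ V]

variable (V) in
/-- Translation acting on `ℂ[X] ⊗ V` through the polynomial factor. -/
noncomputable def translateT (c : σ → ℂ) : Module.End ℂ (MvPolynomial σ ℂ ⊗[ℂ] V) :=
  (translate c).toLinearMap.rTensor V

@[simp] theorem translateT_tmul (c : σ → ℂ) (p : MvPolynomial σ ℂ) (v : V) :
    translateT V c (p ⊗ₜ v) = translate c p ⊗ₜ v := rfl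

theorem translateT_translateT (c d : σ → ℂ) (w : MvPolynomial σ ℂ ⊗[ℂ] V) :
    translateT V c (translateT V d w) = translateT V (c + d) w := by
  induction w with
  | zero => simp
  | add x y hx hy => simp only [map_add, hx, hy]
  | tmul p v => simp [translate_translate]

@[simp] theorem translateT_zero (w : MvPolynomial σ ℂ ⊗[ℂ] V) : translateT V 0 w = w := by
  induction w with
  | zero => simp
  | add x y hx hy => simp only [map_add, hx, hy]
  | tmul p v => simp

theorem mem_maxGenEigenspace_translateT (c : σ → ℂ) (w : MvPolynomial σ ℂ ⊗[ℂ] V) :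
    w ∈ (translateT V c).maxGenEigenspace 1 := by
  induction w with
  | zero => exact Submodule.zero_mem _
  | add x y hx hy => exact Submodule.add_mem _ hx hy
  | tmul p v =>
    have := map_mem_maxGenEigenspace (f := (translate c).toLinearMap) (g := translateT V c)
      (y := 1) ((TensorProduct.mk ℂ _ V).flip v) (by intro m; simp)
      (mem_maxGenEigenspace_translate c p)
    simpa using this

/-- Translations are unipotent. -/
theorem eq_one_of_translateT_eq_smul {c : σ → ℂ} {z : ℂ} {w : MvPolynomial σ ℂ ⊗[ℂ] V}
    (hw : w ≠ 0) (h : translateT V c w = z • w) : z = 1 := by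
  obtain ⟨k, hk⟩ := (mem_maxGenEigenspace _ _ _).1 (mem_maxGenEigenspace_translateT c w)
  -- On an eigenvector the nilpotent operator acts by the scalar `z - 1`, which must then vanish.
  have : ∀ k : ℕ, ((translateT V c - (1 : ℂ) • 1) ^ k) w = (z - 1) ^ k • w := by
    intro k
    induction k with
    | zero => simp
    | succ k ih =>
      rw [pow_succ', Module.End.mul_apply, ih, map_smul]
      simp only [one_smul, LinearMap.sub_apply, h, Module.End.one_apply]
      rw [pow_succ, mul_smul, sub_smul, one_smul]
  rw [this] at hk
  exact sub_eq_zero.1 (eq_zero_of_pow_eq_zero ((smul_eq_zero.1 hk).resolve_right hw))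

variable (σ V) in
/-- Evaluation of the polynomial factor at the origin. -/
noncomputable def evalT : MvPolynomial σ ℂ ⊗[ℂ] V →ₗ[ℂ] V :=
  (TensorProduct.lid ℂ V).toLinearMap ∘ₗ (aeval (0 : σ → ℂ)).toLinearMap.rTensor V

@[simp] theorem evalT_tmul (p : MvPolynomial σ ℂ) (v : V) :
    evalT σ V (p ⊗ₜ v) = eval 0 p • v := by
  simp [evalT]

theorem one_tmul_injective {v w : V}
    (h : (1 : MvPolynomial σ ℂ) ⊗ₜ[ℂ] v = 1 ⊗ₜ w) : v = w := by
  simpa using congrArg (evalT σ V) h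

theorem equivFinsuppOfBasisRight_rTensor {M N κ : Type*} [AddCommGroup M] [Module ℂ M]
    [AddCommGroup N] [Module ℂ N] [DecidableEq κ] (b : Module.Basis κ ℂ N) (f : Module.End ℂ M)
    (w : M ⊗[ℂ] N) (i : κ) :
    TensorProduct.equivFinsuppOfBasisRight b (f.rTensor N w) i =
      f (TensorProduct.equivFinsuppOfBasisRight b w i) := by
  induction w with
  | zero => simp
  | add x y hx hy => simp only [map_add, Finsupp.add_apply, hx, hy]
  | tmul p v => simp

/-- The coordinates of `w` along a basis of `V` are polynomials with the same periods, so each is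
constant by `eq_C_of_translate_eq`. -/
theorem eq_one_tmul_of_translateT_eq [Finite σ] [DecidableEq σ] {b : σ → ℂ}
    (hb : ∀ i, b i = 1 ∨ b i = -1) {w : MvPolynomial σ ℂ ⊗[ℂ] V}
    (h : ∀ i, translateT V (Pi.single i (b i)) w = w) : w = 1 ⊗ₜ evalT σ V w := by
  classical
  let B := Module.Basis.ofVectorSpace ℂ V
  -- `Q` replaces a polynomial by its constant term, so the claim says that `Q ⊗ 1` fixes `w`, which
  -- can be checked coordinatewise.
  let Q : Module.End ℂ (MvPolynomial σ ℂ) :=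
    (Algebra.linearMap ℂ (MvPolynomial σ ℂ)) ∘ₗ (aeval (0 : σ → ℂ)).toLinearMap
  have hQ : ∀ u : MvPolynomial σ ℂ ⊗[ℂ] V, Q.rTensor V u = 1 ⊗ₜ evalT σ V u := by
    intro u
    induction u with
    | zero => simp
    | add x y hx hy => simp only [map_add, hx, hy, TensorProduct.tmul_add]
    | tmul p v =>
      rw [LinearMap.rTensor_tmul, evalT_tmul, ← TensorProduct.smul_tmul]
      simp [Q, MvPolynomial.smul_eq_C_mul]
  rw [← hQ]
  apply (TensorProduct.equivFinsuppOfBasisRight B).injective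
  ext1 i
  rw [equivFinsuppOfBasisRight_rTensor]
  have := eq_C_of_translate_eq hb (p := TensorProduct.equivFinsuppOfBasisRight B w i) (by
    intro j
    have := congrArg (fun u => TensorProduct.equivFinsuppOfBasisRight B u i) (h j)
    simpa only [translateT, equivFinsuppOfBasisRight_rTensor, AlgHom.toLinearMap_apply] using this)
  rw [this]
  simp [Q]

end TranslateTensor

end PGCA

/-! ### A polynomial model of the tensor product modules -/

namespace PGCA

open MvPolynomial Module.End Filter

/-- The degree of a basis vector. -/
def Idx.deg : Idx → ℤ
  | .L n => n
  | .H n => n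
  | .I n => n
  | .J n => n

/-- The basis vector of the same type in another degree. -/
def Idx.withDeg : Idx → ℤ → Idx
  | .L _, n => .L n
  | .H _, n => .H n
  | .I _, n => .I n
  | .J _, n => .J n

@[simp] theorem Idx.deg_withDeg (a : Idx) (n : ℤ) : (a.withDeg n).deg = n := by cases a <;> rfl

theorem basis_mem_grade (a : Idx) : basis a ∈ grade a.deg := by
  apply Submodule.subset_span
  cases a <;> simp [Idx.deg, L, H, I, J]

/-- The type (`Ω` or `Γ`) and the parameters of a tensor factor. -/
@[ext] structure FactorParam where
  /-- Whether the factor is an `Ω`-module (otherwise it is a `Γ`-module). -/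
  isOmega : Bool
  /-- The first parameter. -/
  lam : ℂˣ
  /-- The second parameter. -/
  sig : ℂˣ
  /-- The third parameter. -/
  eta : ℂ

/-- The translation of the second variable that occurs in the module. -/
def FactorParam.sgn (p : FactorParam) : ℂ := if p.isOmega then 1 else -1

/-- The polynomials in two variables for each tensor factor. -/
abbrev Poly (K : Type*) := MvPolynomial (K × Fin 2) ℂ

section Model

variable {K : Type*} [DecidableEq K] (c : K → FactorParam)

/-- The part of the action of a basis vector on the `k`-th factor that does not depend on its
degree. -/
noncomputable def coefConst (k : K) : Idx → Module.End ℂ (Poly K)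
  | .L _ => LinearMap.mulLeft ℂ (X (k, 0))
  | .H _ => LinearMap.mulLeft ℂ (X (k, 1))
  | .I _ => if (c k).isOmega then
      ((c k).sig : ℂ) • (translate (Pi.single (k, 1) (c k).sgn)).toLinearMap else 0
  | .J _ => if (c k).isOmega then 0 else
      ((c k).sig : ℂ) • (translate (Pi.single (k, 1) (c k).sgn)).toLinearMap

/-- The part of the action of a basis vector on the `k`-th factor that is linear in its degree. -/
noncomputable def coefLin (k : K) : Idx → Module.End ℂ (Poly K)
  | .L _ => LinearMap.mulLeft ℂ (C (c k).eta - C (c k).sgn * X (k, 1))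
  | _ => 0

/-- The action of a basis vector on the `k`-th factor. -/
noncomputable def factorOp (k : K) (a : Idx) : Module.End ℂ (Poly K) :=
  (((c k).lam ^ a.deg : ℂˣ) : ℂ) • ((coefConst c k a + (a.deg : ℂ) • coefLin c k a) ∘ₗ
    (translate (Pi.single (k, 0) (a.deg : ℂ))).toLinearMap)

@[simp] theorem coefConst_withDeg (k : K) (a : Idx) (n : ℤ) :
    coefConst c k (a.withDeg n) = coefConst c k a := by cases a <;> rfl

omit [DecidableEq K] in
@[simp] theorem coefLin_withDeg (k : K) (a : Idx) (n : ℤ) :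
    coefLin c k (a.withDeg n) = coefLin c k a := by cases a <;> rfl

theorem factorOp_one (k : K) (a : Idx) :
    factorOp c k a 1 = (((c k).lam ^ a.deg : ℂˣ) : ℂ) •
      (coefConst c k a 1 + (a.deg : ℂ) • coefLin c k a 1) := by
  simp [factorOp]

variable (V : Type*) [AddCommGroup V] [Module ℂ V]

/-- The action of a basis vector on the `k`-th factor of `ℂ[X] ⊗ V`. -/
noncomputable def factorT (k : K) (a : Idx) : Module.End ℂ (Poly K ⊗[ℂ] V) :=
  (factorOp c k a).rTensor V

variable [LieRingModule Alg V] [LieModule ℂ Alg V] [Fintype K]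

/-- The action of a basis vector on `ℂ[X] ⊗ V`. -/
noncomputable def totalOp (a : Idx) : Module.End ℂ (Poly K ⊗[ℂ] V) :=
  ∑ k, factorT c V k a + (LieModule.toEnd ℂ Alg V (basis a)).lTensor (Poly K)

variable {V}

theorem totalOp_tmul (a : Idx) (p : Poly K) (v : V) :
    totalOp c V a (p ⊗ₜ v) = ∑ k, factorOp c k a p ⊗ₜ[ℂ] v + p ⊗ₜ ⁅basis a, v⁆ := by
  simp [totalOp, factorT, LinearMap.sum_apply]

omit [Fintype K] [LieRingModule Alg V] [LieModule ℂ Alg V] in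
theorem factorT_apply (k : K) (a : Idx) (w : Poly K ⊗[ℂ] V) :
    factorT c V k a w = (((c k).lam ^ a.deg : ℂˣ) : ℂ) •
      ((coefConst c k a).rTensor V (translateT V (Pi.single (k, 0) (a.deg : ℂ)) w) +
        (a.deg : ℂ) •
          (coefLin c k a).rTensor V (translateT V (Pi.single (k, 0) (a.deg : ℂ)) w)) := by
  simp only [factorT, factorOp, LinearMap.rTensor_smul, LinearMap.rTensor_comp,
    LinearMap.rTensor_add, LinearMap.smul_apply, LinearMap.comp_apply, LinearMap.add_apply,
    translateT]

/-! ### Distinctness of the first parameters -/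

/-- `1` for the basis vectors `L_n` and `0` for the other ones. -/
def Idx.isL : Idx → ℂ
  | .L _ => 1
  | _ => 0

omit [Fintype K] in
-- The variable `X (k, 0)` enters as a multiplier only in the action of `L_n` on the factor `k`.
-- Translating that multiplier to `X (k, 0) - m` produces the correction term, which depends on the
-- factor only through `lam` and the translation.
theorem translate_factorOp (k j : K) (m : ℂ) (a : Idx) (p : Poly K) :
    translate (Pi.single (k, 0) m) (factorOp c j a p) =
      factorOp c j a (translate (Pi.single (k, 0) m) p) -
        (if j = k then a.isL * m * (((c k).lam ^ a.deg : ℂˣ) : ℂ) else 0) •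
          translate (Pi.single (k, 0) (m + a.deg)) p := by
  have h0 : (Pi.single (k, 0) m : K × Fin 2 → ℂ) (j, 0) = if j = k then m else 0 := by
    simp [Pi.single_apply]
  have h1 : (Pi.single (k, 0) m : K × Fin 2 → ℂ) (j, 1) = 0 := by
    simp
  rcases a with n | n | n | n
  · by_cases hjk : j = k
    · subst hjk
      simp only [factorOp, coefConst, coefLin, Idx.deg, Idx.isL, LinearMap.smul_apply,
        LinearMap.comp_apply, LinearMap.add_apply, LinearMap.mulLeft_apply, map_add,
        map_mul, map_sub, translate_X, translate_C, h0, h1, AlgHom.toLinearMap_apply,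
        translate_translate, if_true, Pi.single_add, MvPolynomial.smul_eq_C_mul, C_0, C_1,
        add_comm (Pi.single (j, 0) (n : ℂ) : K × Fin 2 → ℂ) (Pi.single (j, 0) m)]
      ring
    · simp only [factorOp, coefConst, coefLin, Idx.deg, Idx.isL, LinearMap.smul_apply,
        LinearMap.comp_apply, LinearMap.add_apply, LinearMap.mulLeft_apply, map_add,
        map_mul, map_sub, translate_X, translate_C, h0, h1, AlgHom.toLinearMap_apply,
        translate_translate, if_neg hjk, MvPolynomial.smul_eq_C_mul, C_0,
        add_comm (Pi.single (j, 0) (n : ℂ) : K × Fin 2 → ℂ) (Pi.single (k, 0) m)]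
      ring
  · simp [factorOp, coefConst, coefLin, Idx.deg, Idx.isL, translate_translate, add_comm]
  · simp only [factorOp, coefConst, coefLin, Idx.deg, Idx.isL]
    split_ifs <;> simp [translate_translate, add_comm, add_left_comm]
  · simp only [factorOp, coefConst, coefLin, Idx.deg, Idx.isL]
    split_ifs <;> simp [translate_translate, add_comm, add_left_comm]

theorem translateT_totalOp (k : K) (m : ℂ) (a : Idx) (w : Poly K ⊗[ℂ] V) :
    translateT V (Pi.single (k, 0) m) (totalOp c V a w) =
      totalOp c V a (translateT V (Pi.single (k, 0) m) w) -
        (a.isL * m * (((c k).lam ^ a.deg : ℂˣ) : ℂ)) •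
          translateT V (Pi.single (k, 0) (m + a.deg)) w := by
  induction w with
  | zero => simp
  | add x y hx hy => simp only [map_add, hx, hy, smul_add]; abel
  | tmul p v =>
    simp only [totalOp_tmul, map_add, map_sum, translateT_tmul, translate_factorOp,
      TensorProduct.sub_tmul, Finset.sum_sub_distrib, ← TensorProduct.sum_tmul]
    simp only [ite_smul, zero_smul, Finset.sum_ite_eq', Finset.mem_univ, if_true,
      TensorProduct.smul_tmul']
    abel

/-- If `ℂ[X] ⊗ V` has no proper nonzero invariant subspace, the first parameters are pairwise
distinct. -/
theorem lam_injective_of_invariant [Nontrivial V]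
    (hirr : ∀ N : Submodule ℂ (Poly K ⊗[ℂ] V), (∀ a, ∀ w ∈ N, totalOp c V a w ∈ N) →
      N = ⊥ ∨ N = ⊤) : Function.Injective fun k => (c k).lam := by
  intro k l hkl
  by_contra hne
  obtain ⟨v, hv⟩ := exists_ne (0 : V)
  -- With equal first parameters, the correction terms of `translateT_totalOp` for `k` and `l` agree
  -- on `N`, so `N` is invariant. It contains `1 ⊗ v` but not `X (k, 0) ⊗ v`.
  let N : Submodule ℂ (Poly K ⊗[ℂ] V) := ⨅ m : ℂ,
    LinearMap.eqLocus (translateT V (Pi.single (k, 0) m)) (translateT V (Pi.single (l, 0) m))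
  have hN : ∀ w, w ∈ N ↔ ∀ m : ℂ,
      translateT V (Pi.single (k, 0) m) w = translateT V (Pi.single (l, 0) m) w := by
    intro w
    simp [N, LinearMap.mem_eqLocus]
  have hinv : ∀ a, ∀ w ∈ N, totalOp c V a w ∈ N := by
    intro a w hw
    rw [hN] at hw ⊢
    intro m
    rw [translateT_totalOp, translateT_totalOp, hw, hw]
    simp only at hkl
    rw [hkl]
  rcases hirr N hinv with h | h
  · have h1 : (1 : Poly K) ⊗ₜ[ℂ] v ∈ N := by
      rw [hN]; intro m; simp
    rw [h, Submodule.mem_bot, ← TensorProduct.tmul_zero V (1 : Poly K)] at h1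
    exact hv (one_tmul_injective h1)
  · have h1 : (X (k, 0) : Poly K) ⊗ₜ[ℂ] v ∈ N := by rw [h]; trivial
    rw [hN] at h1
    -- At the origin the translation in the factor `k` gives `-v`, and the one in the factor `l`
    -- gives `0`.
    have h2 := congrArg (evalT _ V) (h1 1)
    have h3 : (Pi.single (l, 0) 1 : K × Fin 2 → ℂ) (k, 0) = 0 := by
      simp [hne]
    simp [h3] at h2
    exact hv h2

end Model

/-! ### Isomorphisms between the models -/

section Sequences

variable {K : Type*} [DecidableEq K] (c : K → FactorParam)
variable (V : Type*) [AddCommGroup V] [Module ℂ V]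

/-- The sequence is `(A + n • B)` applied to `λ ^ n • τ ^ n w` with `τ` a locally unipotent
translation. The factor `λ ^ n` moves the eigenvalue from 1 to `λ`, and multiplication by `n`
preserves it. -/
theorem factorT_mem_maxGenEigenspace (k : K) (a : Idx) (w : Poly K ⊗[ℂ] V) :
    (fun n : ℕ => factorT c V k (a.withDeg n) w) ∈
      (seqShift (Poly K ⊗[ℂ] V)).maxGenEigenspace ((c k).lam : ℂ) := by
  have key : ∀ B : Module.End ℂ (Poly K ⊗[ℂ] V),
      (fun n : ℕ => ((c k).lam : ℂ) ^ n • B (translateT V (Pi.single (k, 0) (n : ℂ)) w)) ∈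
        (seqShift (Poly K ⊗[ℂ] V)).maxGenEigenspace ((c k).lam : ℂ) := by
    intro B
    let F : (Poly K ⊗[ℂ] V) →ₗ[ℂ] (ℕ → Poly K ⊗[ℂ] V) := LinearMap.pi fun n : ℕ =>
      ((c k).lam : ℂ) ^ n • B ∘ₗ translateT V (Pi.single (k, 0) (n : ℂ))
    have := map_mem_maxGenEigenspace (f := translateT V (Pi.single (k, 0) (1 : ℂ)))
      (g := seqShift (Poly K ⊗[ℂ] V)) (y := ((c k).lam : ℂ)) F (by
        intro w
        ext1 n
        simp [F, seqShift_apply, translateT_translateT, pow_succ', mul_smul, ← Pi.single_add])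
      (mem_maxGenEigenspace_translateT _ w)
    rwa [mul_one] at this
  have := Submodule.add_mem _ (key ((coefConst c k a).rTensor V))
    (natCast_smul_mem_maxGenEigenspace (key ((coefLin c k a).rTensor V)))
  convert this using 1
  ext1 n
  rw [factorT_apply]
  simp only [Idx.deg_withDeg, coefConst_withDeg, coefLin_withDeg, zpow_natCast,
    Units.val_pow_eq_pow_val, Int.cast_natCast, smul_add, Pi.add_apply, smul_comm ((n : ℕ) : ℂ)]

end Sequences

section Iso

variable {K K' : Type*} [DecidableEq K] [DecidableEq K'] [Fintype K] [Fintype K']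
  {c : K → FactorParam} {c' : K' → FactorParam}
  {V W : Type*} [AddCommGroup V] [Module ℂ V] [LieRingModule Alg V] [LieModule ℂ Alg V]
  [AddCommGroup W] [Module ℂ W] [LieRingModule Alg W] [LieModule ℂ Alg W]

theorem eventually_totalOp_eq (hV : IsRestricted V) (a : Idx) (w : Poly K ⊗[ℂ] V) :
    ∀ᶠ n : ℕ in atTop, totalOp c V (a.withDeg n) w = ∑ k, factorT c V k (a.withDeg n) w := by
  induction w with
  | zero => simp
  | add x y hx hy =>
    filter_upwards [hx, hy] with n hx hy
    simp only [map_add, hx, hy, Finset.sum_add_distrib]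
  | tmul p v =>
    obtain ⟨i, hi⟩ := hV v
    filter_upwards [eventually_ge_atTop i] with n hn
    have := hi n (by exact_mod_cast hn) (basis (a.withDeg n)) (by
      simpa using basis_mem_grade (a.withDeg n))
    simp [totalOp_tmul, this, factorT]

/-- An equivariant map transforms the action on a factor into the action on the factor with the
same first parameter. -/
theorem sum_factorT_eq (hV : IsRestricted V) (hW : IsRestricted W)
    (Φ : Poly K ⊗[ℂ] V →ₗ[ℂ] Poly K' ⊗[ℂ] W)
    (hΦ : ∀ a w, Φ (totalOp c V a w) = totalOp c' W a (Φ w))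
    (z : ℂˣ) (a : Idx) (n : ℕ) (w : Poly K ⊗[ℂ] V) :
    ∑ k with (c k).lam = z, Φ (factorT c V k (a.withDeg n) w) =
      ∑ j with (c' j).lam = z, factorT c' W j (a.withDeg n) (Φ w) := by
  classical
  -- `S` collects the bases from both sides. Summing `f` over `S` gives the difference of the two
  -- total actions for large `n`, which vanishes by equivariance; independence then gives `f z = 0`
  -- at every `n`, including 0 and 1.
  let S : Finset ℂ := (Finset.univ.image fun k => ((c k).lam : ℂ)) ∪
    ((Finset.univ.image fun j => ((c' j).lam : ℂ)) ∪ {(z : ℂ)})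
  let f : ℂ → ℕ → Poly K' ⊗[ℂ] W := fun y n =>
    ∑ k with ((c k).lam : ℂ) = y, Φ (factorT c V k (a.withDeg n) w) -
      ∑ j with ((c' j).lam : ℂ) = y, factorT c' W j (a.withDeg n) (Φ w)
  have hf : f z = 0 := by
    refine eq_zero_of_eventually_sum_eq_zero S ?_ f ?_ ?_ z (by simp [S])
    · simpa [S] using z.ne_zero.symm
    · intro y _
      have h1 : (∑ k with ((c k).lam : ℂ) = y,
          fun n : ℕ => Φ (factorT c V k (a.withDeg n) w)) ∈
          (seqShift (Poly K' ⊗[ℂ] W)).maxGenEigenspace y := by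
        refine Submodule.sum_mem _ fun k hk => ?_
        rw [← (Finset.mem_filter.1 hk).2]
        have := map_mem_maxGenEigenspace (f := seqShift (Poly K ⊗[ℂ] V))
          (g := seqShift (Poly K' ⊗[ℂ] W)) (y := 1) (Φ.compLeft ℕ) (by
            intro m; ext1 n; simp [seqShift_apply]) (factorT_mem_maxGenEigenspace c V k a w)
        rwa [one_mul] at this
      have h2 : (∑ j with ((c' j).lam : ℂ) = y,
          fun n : ℕ => factorT c' W j (a.withDeg n) (Φ w)) ∈
          (seqShift (Poly K' ⊗[ℂ] W)).maxGenEigenspace y := by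
        refine Submodule.sum_mem _ fun k hk => ?_
        rw [← (Finset.mem_filter.1 hk).2]
        exact factorT_mem_maxGenEigenspace c' W k a (Φ w)
      convert Submodule.sub_mem _ h1 h2 using 1
      ext1 n
      simp [f]
    · filter_upwards [eventually_totalOp_eq (c := c) hV a w,
        eventually_totalOp_eq (c := c') hW a (Φ w)] with n h1 h2
      simp only [f, Finset.sum_sub_distrib]
      rw [Finset.sum_fiberwise_of_maps_to, Finset.sum_fiberwise_of_maps_to, ← h2, ← map_sum, ← h1,
        hΦ, sub_self]
      · intro j _; simp [S]
      · intro k _; simp [S]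
  have := congrFun hf n
  simp only [f, Pi.zero_apply, sub_eq_zero, Units.val_inj] at this
  exact this

end Iso

end PGCA

namespace PGCA

open MvPolynomial Module.End Filter

/-! ### Recovering the parameters and the restricted module from an isomorphism -/

section Iso

variable {K K' : Type*} [DecidableEq K] [DecidableEq K']
  {c : K → FactorParam} {c' : K' → FactorParam}
  {V W : Type*} [AddCommGroup V] [Module ℂ V] [AddCommGroup W] [Module ℂ W]

omit [DecidableEq K] in
theorem rTensor_mulLeft_X_injective (i : K × Fin 2) :
    Function.Injective ((LinearMap.mulLeft ℂ (X i : Poly K)).rTensor V) :=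
  Module.Flat.rTensor_preserves_injective_linearMap _
    (mul_right_injective₀ (X_ne_zero i))

omit [DecidableEq K] in
theorem one_tmul_ne_zero {v : V} (hv : v ≠ 0) : (1 : Poly K) ⊗ₜ[ℂ] v ≠ 0 := by
  intro h
  rw [← TensorProduct.tmul_zero V (1 : Poly K)] at h
  exact hv (one_tmul_injective h)

variable (c c') in
/-- `Φ` transforms the operators attached to the factor `k` into those of the factor `j`. -/
structure Intertwines (Φ : Poly K ⊗[ℂ] V ≃ₗ[ℂ] Poly K' ⊗[ℂ] W) (k : K) (j : K') : Prop where
  lam_eq : (c k).lam = (c' j).lam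
  const : ∀ a w, Φ ((coefConst c k a).rTensor V w) = (coefConst c' j a).rTensor W (Φ w)
  trans : ∀ w, Φ (translateT V (Pi.single (k, 0) 1) w) =
    translateT W (Pi.single (j, 0) 1) (Φ w)
  lin : ∀ a v, Φ (coefLin c k a 1 ⊗ₜ v) = (coefLin c' j a).rTensor W (Φ (1 ⊗ₜ v))

namespace Intertwines

variable {Φ : Poly K ⊗[ℂ] V ≃ₗ[ℂ] Poly K' ⊗[ℂ] W} {k : K} {j : K'}

/-- On an `Ω`-factor `J_0` vanishes and `I_0` does not; on a `Γ`-factor the roles are exchanged. -/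
theorem isOmega_eq [Nontrivial V] (h : Intertwines c c' Φ k j) :
    (c k).isOmega = (c' j).isOmega := by
  obtain ⟨v, hv⟩ := exists_ne (0 : V)
  by_contra hne
  have h1 := h.const (.I 0) (1 ⊗ₜ v)
  have h2 := h.const (.J 0) (1 ⊗ₜ v)
  cases hk : (c k).isOmega <;> cases hj : (c' j).isOmega <;>
    simp_all [coefConst, LinearMap.rTensor_smul, one_tmul_ne_zero hv]
  rw [← h1] at h2
  simp [one_tmul_ne_zero hv] at h2

theorem sgn_eq [Nontrivial V] (h : Intertwines c c' Φ k j) : (c k).sgn = (c' j).sgn := by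
  simp [FactorParam.sgn, h.isOmega_eq]

theorem sig_smul_eq [Nontrivial V] (h : Intertwines c c' Φ k j) (v : V) :
    ((c k).sig : ℂ) • Φ (1 ⊗ₜ v) =
      ((c' j).sig : ℂ) • translateT W (Pi.single (j, 1) (c' j).sgn) (Φ (1 ⊗ₜ v)) := by
  have h1 := h.const (.I 0) (1 ⊗ₜ v)
  have h2 := h.const (.J 0) (1 ⊗ₜ v)
  have h3 := h.isOmega_eq
  cases hj : (c' j).isOmega <;> rw [hj] at h3
  · simpa [coefConst, h3, hj, translateT, LinearMap.rTensor_smul, ← TensorProduct.smul_tmul'] using h2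
  · simpa [coefConst, h3, hj, translateT, LinearMap.rTensor_smul, ← TensorProduct.smul_tmul'] using h1

/-- By `sig_smul_eq`, `Φ (1 ⊗ v)` is an eigenvector of a translation whose eigenvalue is the ratio
of the two parameters; unipotence makes that ratio 1. -/
theorem sig_eq [Nontrivial V] (h : Intertwines c c' Φ k j) : (c k).sig = (c' j).sig := by
  obtain ⟨v, hv⟩ := exists_ne (0 : V)
  have h1 := h.sig_smul_eq v
  have h2 : translateT W (Pi.single (j, 1) (c' j).sgn) (Φ (1 ⊗ₜ v)) =
      (((c' j).sig : ℂ)⁻¹ * (c k).sig) • Φ (1 ⊗ₜ v) := by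
    rw [mul_smul, h1, inv_smul_smul₀ (Units.ne_zero _)]
  have h3 := eq_one_of_translateT_eq_smul
    (by rw [Ne, LinearEquiv.map_eq_zero_iff]; exact one_tmul_ne_zero hv) h2
  rw [inv_mul_eq_one₀ (Units.ne_zero _)] at h3
  exact (Units.ext h3).symm

theorem translateT_snd [Nontrivial V] (h : Intertwines c c' Φ k j) (v : V) :
    translateT W (Pi.single (j, 1) (c' j).sgn) (Φ (1 ⊗ₜ v)) = Φ (1 ⊗ₜ v) := by
  have h1 := h.sig_smul_eq v
  rw [h.sig_eq] at h1
  exact (smul_right_injective _ (Units.ne_zero (c' j).sig) h1).symm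

theorem translateT_fst (h : Intertwines c c' Φ k j) (v : V) :
    translateT W (Pi.single (j, 0) 1) (Φ (1 ⊗ₜ v)) = Φ (1 ⊗ₜ v) := by
  rw [← h.trans]; simp

/-- The linear coefficient of `L_n` is multiplication by `η - sgn • X (k, 1)`. The second term is
already matched through `H_0`, so the scalar `η` is what remains to compare. -/
theorem eta_eq [Nontrivial V] (h : Intertwines c c' Φ k j) : (c k).eta = (c' j).eta := by
  obtain ⟨v, hv⟩ := exists_ne (0 : V)
  have h1 := h.lin (.L 0) v
  have h2 := h.const (.H 0) (1 ⊗ₜ v)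
  have key : ∀ (e s : ℂ) (i : K') (u : Poly K' ⊗[ℂ] W),
      (LinearMap.mulLeft ℂ (C e - C s * X (i, 1))).rTensor W u =
        e • u - s • (LinearMap.mulLeft ℂ (X (i, 1))).rTensor W u := by
    intro e s i u
    induction u with
    | zero => simp
    | add x y hx hy => simp only [map_add, hx, hy, smul_add]; abel
    | tmul p w => simp [sub_mul, TensorProduct.sub_tmul, TensorProduct.smul_tmul',
        MvPolynomial.smul_eq_C_mul, mul_assoc]
  simp only [coefLin, coefConst, LinearMap.mulLeft_apply, mul_one, LinearMap.rTensor_tmul] at h1 h2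
  rw [key, ← h2, TensorProduct.sub_tmul, ← MvPolynomial.smul_eq_C_mul, ← TensorProduct.smul_tmul',
    map_sub, map_smul, h.sgn_eq, sub_left_inj, ← mul_one (C (c k).eta),
    ← MvPolynomial.smul_eq_C_mul, ← TensorProduct.smul_tmul', map_smul] at h1
  have h3 : Φ (1 ⊗ₜ v) ≠ 0 := by
    rw [Ne, LinearEquiv.map_eq_zero_iff]; exact one_tmul_ne_zero hv
  exact smul_left_injective ℂ h3 h1

theorem param_eq [Nontrivial V] (h : Intertwines c c' Φ k j) : c k = c' j :=
  FactorParam.ext h.isOmega_eq h.lam_eq h.sig_eq h.eta_eq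

end Intertwines

variable [LieRingModule Alg V] [LieModule ℂ Alg V] [LieRingModule Alg W] [LieModule ℂ Alg W]
  [Fintype K] [Fintype K']

/-- Without a partner, the sum over the fibre of `lam` on the target side is empty, so `H_0` on the
factor `k` would kill `1 ⊗ v`, although it is multiplication by a variable. -/
theorem exists_lam_eq [Nontrivial V] (hV : IsRestricted V) (hW : IsRestricted W)
    (Φ : Poly K ⊗[ℂ] V ≃ₗ[ℂ] Poly K' ⊗[ℂ] W)
    (hΦ : ∀ a w, Φ (totalOp c V a w) = totalOp c' W a (Φ w))
    (hc : Function.Injective fun k => (c k).lam) (k : K) : ∃ j, (c k).lam = (c' j).lam := by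
  by_contra! hne
  obtain ⟨v, hv⟩ := exists_ne (0 : V)
  have h := sum_factorT_eq hV hW Φ.toLinearMap hΦ (c k).lam (.H 0) 0 (1 ⊗ₜ v)
  have h1 : Finset.univ.filter (fun j => (c' j).lam = (c k).lam) = ∅ := by
    ext j; simpa using (hne j).symm
  have h2 : Finset.univ.filter (fun l => (c l).lam = (c k).lam) = {k} := by
    ext l; simpa using ⟨fun h => hc h, fun h => h ▸ rfl⟩
  rw [h1, h2, Finset.sum_singleton, Finset.sum_empty, LinearEquiv.coe_coe,
    LinearEquiv.map_eq_zero_iff, factorT_apply] at h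
  simp only [Idx.deg_withDeg, Nat.cast_zero, zpow_zero, Units.val_one, one_smul, Int.cast_zero,
    zero_smul, add_zero, Pi.single_zero, translateT_zero, coefConst_withDeg] at h
  exact one_tmul_ne_zero hv (rTensor_mulLeft_X_injective (k, 1) (h.trans (map_zero _).symm))

/-- Distinctness reduces both fibre sums to single terms. Degree 0 gives `const`; `H_1` gives
`trans` after cancelling multiplication by `X (j, 1)`; degree 1 on `1 ⊗ v`, which translations fix,
gives `lin`. -/
theorem intertwines_of_lam_eq (hV : IsRestricted V) (hW : IsRestricted W)
    (Φ : Poly K ⊗[ℂ] V ≃ₗ[ℂ] Poly K' ⊗[ℂ] W)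
    (hΦ : ∀ a w, Φ (totalOp c V a w) = totalOp c' W a (Φ w))
    (hc : Function.Injective fun k => (c k).lam) (hc' : Function.Injective fun j => (c' j).lam)
    {k : K} {j : K'} (hkj : (c k).lam = (c' j).lam) : Intertwines c c' Φ k j := by
  have comm : ∀ (a : Idx) (n : ℕ) (w : Poly K ⊗[ℂ] V),
      Φ (factorT c V k (a.withDeg n) w) = factorT c' W j (a.withDeg n) (Φ w) := by
    intro a n w
    have h := sum_factorT_eq hV hW Φ.toLinearMap hΦ (c k).lam a n w
    have h1 : Finset.univ.filter (fun i => (c' i).lam = (c k).lam) = {j} := by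
      ext i; rw [hkj]; simpa using ⟨fun h => hc' h, fun h => h ▸ rfl⟩
    have h2 : Finset.univ.filter (fun l => (c l).lam = (c k).lam) = {k} := by
      ext l; simpa using ⟨fun h => hc h, fun h => h ▸ rfl⟩
    rwa [h1, h2, Finset.sum_singleton, Finset.sum_singleton] at h
  have const : ∀ a w, Φ ((coefConst c k a).rTensor V w) = (coefConst c' j a).rTensor W (Φ w) := by
    intro a w
    have := comm a 0 w
    simpa [factorT_apply] using this
  have one : ∀ a w, Φ ((coefConst c k a).rTensor V (translateT V (Pi.single (k, 0) 1) w)) +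
        Φ ((coefLin c k a).rTensor V (translateT V (Pi.single (k, 0) 1) w)) =
      (coefConst c' j a).rTensor W (translateT W (Pi.single (j, 0) 1) (Φ w)) +
        (coefLin c' j a).rTensor W (translateT W (Pi.single (j, 0) 1) (Φ w)) := by
    intro a w
    have := comm a 1 w
    rw [factorT_apply, factorT_apply, map_smul, hkj] at this
    simpa using smul_right_injective _ (Units.ne_zero ((c' j).lam ^ (a.withDeg _).deg)) this
  have trans : ∀ w, Φ (translateT V (Pi.single (k, 0) 1) w) =
      translateT W (Pi.single (j, 0) 1) (Φ w) := by
    intro w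
    have h1 := one (.H 0) w
    rw [const] at h1
    simp only [coefLin, LinearMap.rTensor_zero, LinearMap.zero_apply, map_zero, add_zero] at h1
    exact rTensor_mulLeft_X_injective (j, 1) h1
  refine ⟨hkj, const, trans, fun a v => ?_⟩
  have h1 := one a (1 ⊗ₜ v)
  rw [const, trans, add_right_inj, ← trans] at h1
  simpa using h1

/-- An isomorphism between two models with pairwise distinct first parameters forces the
parameters to agree up to a permutation, and the `V`-factors to be isomorphic. -/
theorem exists_equiv_of_iso [Nontrivial V] [Nontrivial W]
    [LieModule.IsIrreducible ℂ Alg W]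
    (hV : IsRestricted V) (hW : IsRestricted W)
    (Φ : Poly K ⊗[ℂ] V ≃ₗ[ℂ] Poly K' ⊗[ℂ] W)
    (hΦ : ∀ a w, Φ (totalOp c V a w) = totalOp c' W a (Φ w))
    (hc : Function.Injective fun k => (c k).lam) (hc' : Function.Injective fun j => (c' j).lam) :
    (∃ π : K ≃ K', ∀ k, c' (π k) = c k) ∧ Nonempty (V ≃ₗ⁅ℂ, Alg⁆ W) := by
  choose f hf using exists_lam_eq hV hW Φ hΦ hc
  have hbij : Function.Bijective f := by
    refine ⟨fun k l h => hc ?_, fun j => ?_⟩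
    · simp only; rw [hf, hf, h]
    · obtain ⟨k, hk⟩ := exists_lam_eq hW hV Φ.symm (c := c') (c' := c) (by
        intro a w
        rw [LinearEquiv.symm_apply_eq, hΦ, LinearEquiv.apply_symm_apply]) hc' j
      exact ⟨k, hc' (by simp only; rw [← hf, hk])⟩
  let π := Equiv.ofBijective f hbij
  have hint : ∀ k, Intertwines c c' Φ k (π k) := fun k =>
    intertwines_of_lam_eq hV hW Φ hΦ hc hc' (hf k)
  refine ⟨⟨π, fun k => (hint k).param_eq.symm⟩, ?_⟩
  let ψ : V →ₗ[ℂ] W := evalT _ W ∘ₗ Φ.toLinearMap ∘ₗ TensorProduct.mk ℂ (Poly K) V 1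
  have hψ : ∀ v, Φ (1 ⊗ₜ v) = 1 ⊗ₜ ψ v := by
    intro v
    -- Every variable of the target belongs to some `π k`, so the two invariances for that factor
    -- cover all coordinates.
    refine eq_one_tmul_of_translateT_eq
      (b := fun i : K' × Fin 2 => if i.2 = 0 then 1 else (c' i.1).sgn) ?_ ?_
    · rintro ⟨j, i⟩
      simp only [FactorParam.sgn]
      split_ifs <;> simp
    · rintro ⟨j, i⟩
      obtain ⟨k, rfl⟩ := π.surjective j
      fin_cases i
      · exact (hint k).translateT_fst v
      · exact (hint k).translateT_snd v
  have hfac : ∀ k a v, Φ (factorOp c k a 1 ⊗ₜ v) = factorOp c' (π k) a 1 ⊗ₜ ψ v := by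
    intro k a v
    have h1 := (hint k).const a (1 ⊗ₜ v)
    have h2 := (hint k).lin a v
    rw [hψ, LinearMap.rTensor_tmul] at h1 h2
    rw [LinearMap.rTensor_tmul] at h1
    simp only [factorOp_one, ← TensorProduct.smul_tmul', TensorProduct.add_tmul, map_smul,
      map_add, h1, h2, (hint k).lam_eq]
  have hlie : ∀ (x : Alg) v, ψ ⁅x, v⁆ = ⁅x, ψ v⁆ := by
    intro x v
    induction x using basis_induction with
    | zero => simp
    | add x y hx hy => simp only [add_lie, map_add, hx, hy]
    | smul r x hx => simp only [smul_lie, map_smul, hx]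
    | single a =>
      have h := hΦ a (1 ⊗ₜ v)
      rw [hψ, totalOp_tmul, totalOp_tmul, map_add, map_sum, hψ] at h
      simp only [hfac] at h
      -- The contributions of the polynomial factors agree after reindexing by `π`; cancelling them
      -- leaves the action on `V` and `W`.
      rw [Equiv.sum_comp π (fun j => factorOp c' j a 1 ⊗ₜ[ℂ] ψ v), add_right_inj] at h
      exact one_tmul_injective h
  let Ψ : V →ₗ⁅ℂ, Alg⁆ W := { ψ with map_lie' := fun {x v} => hlie x v }
  have hinj : Function.Injective Ψ := by
    intro v w h
    have h' : ψ v = ψ w := h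
    apply one_tmul_injective (σ := K × Fin 2)
    apply Φ.injective
    rw [hψ, hψ, h']
  have hsurj : Function.Surjective Ψ := by
    rw [← LieModuleHom.range_eq_top]
    -- The image is a nonzero submodule of the simple module `W`.
    refine (eq_bot_or_eq_top _).resolve_left fun h => ?_
    obtain ⟨v, hv⟩ := exists_ne (0 : V)
    have : Ψ v ∈ Ψ.range := (LieModuleHom.mem_range _ _).2 ⟨v, rfl⟩
    rw [h, LieSubmodule.mem_bot] at this
    exact hv (hinj (this.trans (map_zero Ψ).symm))
  exact ⟨{ Ψ with
    invFun := (LinearEquiv.ofBijective (Ψ : V →ₗ[ℂ] W) ⟨hinj, hsurj⟩).symm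
    left_inv := (LinearEquiv.ofBijective (Ψ : V →ₗ[ℂ] W) ⟨hinj, hsurj⟩).left_inv
    right_inv := (LinearEquiv.ofBijective (Ψ : V →ₗ[ℂ] W) ⟨hinj, hsurj⟩).right_inv }⟩

end Iso

end PGCA

/-! ### The tensor product modules and their polynomial models -/

namespace PGCA

open MvPolynomial

theorem translate_rename {σ τ : Type*} (g : σ → τ) (d : τ → ℂ) (p : MvPolynomial σ ℂ) :
    translate d (rename g p) = rename g (translate (d ∘ g) p) := by
  have : (translate d).comp (rename g) = (rename g).comp (translate (d ∘ g)) := by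
    ext i : 1
    simp
  exact DFunLike.congr_fun this p

theorem shift_eq_translate (a b : ℂ) (p : MvPolynomial (Fin 2) ℂ) :
    shift a b p = translate ![a, b] p := by
  have : shift a b = translate ![a, b] := by
    ext i : 1
    fin_cases i <;> simp [shift]
  rw [this]

/-! ### Permuting the factors of the model -/

section Rename

variable {K K' : Type*} [DecidableEq K] [DecidableEq K'] {c : K → FactorParam}
  {c' : K' → FactorParam}

theorem rename_translate_single (π : K ≃ K') (k : K) (i : Fin 2) (x : ℂ) (p : Poly K) :
    rename (Prod.map π id) (translate (Pi.single (k, i) x) p) =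
      translate (Pi.single (π k, i) x) (rename (Prod.map π id) p) := by
  have : (Pi.single (π k, i) x : K' × Fin 2 → ℂ) ∘ Prod.map π id = Pi.single (k, i) x := by
    ext ⟨j, r⟩
    simp [Pi.single_apply]
  rw [translate_rename, this]

theorem rename_factorOp (π : K ≃ K') (hπ : ∀ k, c' (π k) = c k) (k : K) (a : Idx) (p : Poly K) :
    rename (Prod.map π id) (factorOp c k a p) =
      factorOp c' (π k) a (rename (Prod.map π id) p) := by
  rcases a with n | n | n | n <;>
    simp only [factorOp, coefConst, coefLin, hπ]
  · simp [rename_translate_single]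
  · simp [rename_translate_single]
  · split_ifs <;> simp [rename_translate_single]
  · split_ifs <;> simp [rename_translate_single]

variable {V W : Type*} [AddCommGroup V] [Module ℂ V] [LieRingModule Alg V] [LieModule ℂ Alg V]
  [AddCommGroup W] [Module ℂ W] [LieRingModule Alg W] [LieModule ℂ Alg W]
  [Fintype K] [Fintype K']

theorem exists_iso_of_equiv (π : K ≃ K') (hπ : ∀ k, c' (π k) = c k) (ψ : V ≃ₗ⁅ℂ, Alg⁆ W) :
    ∃ Φ : Poly K ⊗[ℂ] V ≃ₗ[ℂ] Poly K' ⊗[ℂ] W,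
      ∀ a w, Φ (totalOp c V a w) = totalOp c' W a (Φ w) := by
  let r : Poly K ≃ₗ[ℂ] Poly K' :=
    (renameEquiv ℂ (π.prodCongr (Equiv.refl (Fin 2)))).toLinearEquiv
  have hr : ∀ p, r p = rename (Prod.map π id) p := fun p => rfl
  refine ⟨TensorProduct.congr r ψ.toLinearEquiv, fun a w => ?_⟩
  induction w with
  | zero => simp
  | add x y hx hy => simp only [map_add, hx, hy]
  | tmul p v =>
    rw [totalOp_tmul, TensorProduct.congr_tmul, totalOp_tmul, map_add, map_sum]
    simp only [TensorProduct.congr_tmul, hr, rename_factorOp π hπ]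
    rw [Equiv.sum_comp π
      (fun j => factorOp c' j a (rename (Prod.map π id) p) ⊗ₜ[ℂ] ψ.toLinearEquiv v)]
    congr 2
    exact LieModuleHom.map_lie ψ.toLieModuleHom _ _

end Rename

/-! ### Realizing a single factor inside the large polynomial ring -/

section FactorModel

variable {K : Type*} [DecidableEq K] {c : K → FactorParam}

/-- The polynomial `q` does not involve the variables of the factor `k`. -/
def IsFree (k : K) (q : Poly K) : Prop := ∀ i x, translate (Pi.single (k, i) x) q = q

/-- The polynomials in the variables of the factor `k`. -/
noncomputable abbrev incl (k : K) : MvPolynomial (Fin 2) ℂ →ₐ[ℂ] Poly K := rename (k, ·)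

theorem isFree_incl {k j : K} (h : j ≠ k) (f : MvPolynomial (Fin 2) ℂ) : IsFree k (incl j f) := by
  intro i x
  have : (Pi.single (k, i) x : K × Fin 2 → ℂ) ∘ (j, ·) = 0 := by
    ext r
    simp [h]
  rw [translate_rename, this, translate_zero]

theorem IsFree.mul {k : K} {p q : Poly K} (hp : IsFree k p) (hq : IsFree k q) :
    IsFree k (p * q) := by
  intro i x
  rw [map_mul, hp, hq]

theorem IsFree.prod {ι : Type*} {k : K} {s : Finset ι} {p : ι → Poly K}
    (hp : ∀ i ∈ s, IsFree k (p i)) : IsFree k (∏ i ∈ s, p i) := by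
  intro i x
  rw [map_prod]
  exact Finset.prod_congr rfl fun j hj => hp j hj i x

theorem translate_incl_zero (k : K) (x : ℂ) (f : MvPolynomial (Fin 2) ℂ) :
    translate (Pi.single (k, 0) x) (incl k f) = incl k (shift x 0 f) := by
  have : (Pi.single (k, 0) x : K × Fin 2 → ℂ) ∘ (k, ·) = ![x, 0] := by
    ext i
    fin_cases i <;> simp
  rw [translate_rename, shift_eq_translate, this]

theorem translate_incl_one (k : K) (x : ℂ) (f : MvPolynomial (Fin 2) ℂ) :
    translate (Pi.single (k, 1) x) (incl k f) = incl k (shift 0 x f) := by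
  have : (Pi.single (k, 1) x : K × Fin 2 → ℂ) ∘ (k, ·) = ![0, x] := by
    ext i
    fin_cases i <;> simp
  rw [translate_rename, shift_eq_translate, this]

variable (c) in
/-- The module `M` is realized by the action on the factor `k`. -/
def IsModelFactor (k : K) {M : Type*} [AddCommGroup M] [Module ℂ M] [LieRingModule Alg M]
    (u : M ≃ₗ[ℂ] MvPolynomial (Fin 2) ℂ) : Prop :=
  ∀ (a : Idx) (f : M) (q : Poly K), IsFree k q →
    factorOp c k a (incl k (u f) * q) = incl k (u ⁅basis a, f⁆) * q

/-- The identification of `Ω(lam, sig, eta)` with the polynomial ring. -/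
noncomputable def Omega.toPoly (lam sig : ℂˣ) (eta : ℂ) :
    Omega lam sig eta ≃ₗ[ℂ] MvPolynomial (Fin 2) ℂ :=
  LinearEquiv.refl ℂ (MvPolynomial (Fin 2) ℂ)

/-- The identification of `Γ(lam, sig, eta)` with the polynomial ring. -/
noncomputable def Gamma.toPoly (lam sig : ℂˣ) (eta : ℂ) :
    Gamma lam sig eta ≃ₗ[ℂ] MvPolynomial (Fin 2) ℂ :=
  LinearEquiv.refl ℂ (MvPolynomial (Fin 2) ℂ)

theorem Omega.toPoly_lie (lam sig : ℂˣ) (eta : ℂ) (a : Idx) (f : Omega lam sig eta) :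
    Omega.toPoly lam sig eta ⁅basis a, f⁆ =
      omegaOp lam sig eta a (Omega.toPoly lam sig eta f) :=
  Omega.lie_basis lam sig eta a f

theorem Gamma.toPoly_lie (lam sig : ℂˣ) (eta : ℂ) (a : Idx) (f : Gamma lam sig eta) :
    Gamma.toPoly lam sig eta ⁅basis a, f⁆ =
      gammaOp lam sig eta a (Gamma.toPoly lam sig eta f) :=
  Gamma.lie_basis lam sig eta a f

theorem isModelFactor_omega {k : K} {lam sig : ℂˣ} {eta : ℂ} (hk : c k = ⟨true, lam, sig, eta⟩) :
    IsModelFactor c k (Omega.toPoly lam sig eta) := by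
  intro a f q hq
  have hq' : ∀ i x, translate (Pi.single (k, i) x) q = q := hq
  rw [Omega.toPoly_lie]
  generalize Omega.toPoly lam sig eta f = p
  rcases a with n | n | n | n
  · simp [factorOp, coefConst, coefLin, hk, omegaOp, mulShift_apply, FactorParam.sgn, Idx.deg,
      translate_incl_zero, hq', MvPolynomial.smul_eq_C_mul, -eq_intCast]
    ring
  · simp [factorOp, coefConst, coefLin, omegaOp, mulShift_apply, Idx.deg, hk,
      translate_incl_zero, hq', MvPolynomial.smul_eq_C_mul]
    ring
  · simp [factorOp, coefConst, coefLin, hk, omegaOp, mulShift_apply, FactorParam.sgn, Idx.deg,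
      translate_incl_zero, translate_incl_one, shift_shift, hq', MvPolynomial.smul_eq_C_mul]
    ring
  · simp [factorOp, coefConst, coefLin, hk, omegaOp]

theorem isModelFactor_gamma {k : K} {lam sig : ℂˣ} {eta : ℂ} (hk : c k = ⟨false, lam, sig, eta⟩) :
    IsModelFactor c k (Gamma.toPoly lam sig eta) := by
  intro a f q hq
  have hq' : ∀ i x, translate (Pi.single (k, i) x) q = q := hq
  rw [Gamma.toPoly_lie]
  generalize Gamma.toPoly lam sig eta f = p
  rcases a with n | n | n | n
  · simp [factorOp, coefConst, coefLin, hk, gammaOp, mulShift_apply, FactorParam.sgn, Idx.deg,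
      translate_incl_zero, hq', MvPolynomial.smul_eq_C_mul]
    ring
  · simp [factorOp, coefConst, coefLin, gammaOp, mulShift_apply, Idx.deg, hk,
      translate_incl_zero, hq', MvPolynomial.smul_eq_C_mul]
    ring
  · simp [factorOp, coefConst, coefLin, hk, gammaOp]
  · simp [factorOp, coefConst, coefLin, hk, gammaOp, mulShift_apply, FactorParam.sgn, Idx.deg,
      translate_incl_zero, translate_incl_one, shift_shift, hq', MvPolynomial.smul_eq_C_mul]
    ring

end FactorModel

/-! ### Multiplying a family of factors -/

section ProdMap

variable {ι : Type*} [Fintype ι] [DecidableEq ι] {K : Type*} {M : ι → Type*}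
  [∀ i, AddCommGroup (M i)] [∀ i, Module ℂ (M i)]

/-- The multiplication map from a tensor product of polynomial rings. -/
noncomputable def prodMap (u : ∀ i, M i ≃ₗ[ℂ] MvPolynomial (Fin 2) ℂ) (g : ι → K) :
    (⨂[ℂ] i, M i) →ₗ[ℂ] Poly K :=
  PiTensorProduct.lift ((MultilinearMap.mkPiAlgebra ℂ ι (Poly K)).compLinearMap
    fun i => (incl (g i)).toLinearMap ∘ₗ (u i).toLinearMap)

omit [DecidableEq ι] in
theorem prodMap_tprod (u : ∀ i, M i ≃ₗ[ℂ] MvPolynomial (Fin 2) ℂ) (g : ι → K) (m : ∀ i, M i) :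
    prodMap u g (PiTensorProduct.tprod ℂ m) = ∏ i, incl (g i) (u i (m i)) := by
  simp [prodMap]

variable [DecidableEq K] {c : K → FactorParam}

omit [DecidableEq ι] in
theorem isFree_prodMap {u : ∀ i, M i ≃ₗ[ℂ] MvPolynomial (Fin 2) ℂ} {g : ι → K} {k : K}
    (hk : ∀ i, g i ≠ k) (m : ∀ i, M i) :
    IsFree k (prodMap u g (PiTensorProduct.tprod ℂ m)) := by
  rw [prodMap_tprod]
  exact IsFree.prod fun i _ => isFree_incl (hk i) _

variable [∀ i, LieRingModule Alg (M i)] [∀ i, LieModule ℂ Alg (M i)]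

omit [∀ i, LieModule ℂ Alg (M i)] in
-- Injectivity of `g` makes the other factors free of the variables of `g i`, so they can be
-- absorbed into the spectator polynomial of `IsModelFactor`.
theorem factorOp_prodMap {u : ∀ i, M i ≃ₗ[ℂ] MvPolynomial (Fin 2) ℂ} {g : ι → K}
    (hg : Function.Injective g) {i : ι} (hu : IsModelFactor c (g i) (u i)) (a : Idx)
    (m : ∀ i, M i) {q : Poly K} (hq : IsFree (g i) q) :
    factorOp c (g i) a (prodMap u g (PiTensorProduct.tprod ℂ m) * q) =
      prodMap u g (PiTensorProduct.tprod ℂ (Function.update m i ⁅basis a, m i⁆)) * q := by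
  rw [prodMap_tprod, prodMap_tprod, ← Finset.mul_prod_erase _ _ (Finset.mem_univ i),
    ← Finset.mul_prod_erase _ _ (Finset.mem_univ i), mul_assoc, hu, mul_assoc,
    Function.update_self]
  · congr 2
    refine Finset.prod_congr rfl fun j hj => ?_
    rw [Function.update_of_ne (Finset.ne_of_mem_erase hj)]
  · exact IsFree.mul (IsFree.prod fun j hj =>
      isFree_incl (fun h => Finset.ne_of_mem_erase hj (hg h)) _) hq

end ProdMap

/-! ### Both families together, and the identification with the model -/

section Combined

variable {ι κ : Type*} [Fintype ι] [Fintype κ] {M : ι → Type*} {N : κ → Type*}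
  [∀ i, AddCommGroup (M i)] [∀ i, Module ℂ (M i)]
  [∀ i, AddCommGroup (N i)] [∀ i, Module ℂ (N i)]
  (u : ∀ i, M i ≃ₗ[ℂ] MvPolynomial (Fin 2) ℂ) (w : ∀ i, N i ≃ₗ[ℂ] MvPolynomial (Fin 2) ℂ)

/-- The multiplication map from two tensor products of polynomial rings. -/
noncomputable def prodMap₂ : (⨂[ℂ] i, M i) ⊗[ℂ] (⨂[ℂ] j, N j) →ₗ[ℂ] Poly (ι ⊕ κ) :=
  LinearMap.mul' ℂ _ ∘ₗ TensorProduct.map (prodMap u Sum.inl) (prodMap w Sum.inr)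

theorem prodMap₂_tmul (x : ⨂[ℂ] i, M i) (y : ⨂[ℂ] j, N j) :
    prodMap₂ u w (x ⊗ₜ y) = prodMap u Sum.inl x * prodMap w Sum.inr y := by
  simp [prodMap₂]

variable (ι κ) in
/-- The exponents of the monomials in a combined polynomial ring. -/
noncomputable def exponentEquiv :
    ((ι → Fin 2 →₀ ℕ) × (κ → Fin 2 →₀ ℕ)) ≃ ((ι ⊕ κ) × Fin 2 →₀ ℕ) where
  toFun x := Finsupp.equivFunOnFinite.symm fun q => Sum.elim x.1 x.2 q.1 q.2
  invFun d := (fun i => Finsupp.equivFunOnFinite.symm fun r => d (Sum.inl i, r),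
    fun j => Finsupp.equivFunOnFinite.symm fun r => d (Sum.inr j, r))
  left_inv x := by
    ext <;> simp
  right_inv d := by
    ext ⟨i | j, r⟩ <;> simp

/-- Tensors of monomials form a basis, and multiplication sends them bijectively to the monomials in
all the variables. -/
theorem prodMap₂_bijective : Function.Bijective (prodMap₂ u w) := by
  classical
  let B := (Basis.piTensorProduct fun i => (basisMonomials (Fin 2) ℂ).map (u i).symm).tensorProduct
    (Basis.piTensorProduct fun i => (basisMonomials (Fin 2) ℂ).map (w i).symm)
  let E := B.equiv (basisMonomials ((ι ⊕ κ) × Fin 2) ℂ) (exponentEquiv ι κ)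
  have : prodMap₂ u w = E.toLinearMap := by
    refine B.ext fun x => ?_
    rw [LinearEquiv.coe_coe, Module.Basis.equiv_apply, Module.Basis.tensorProduct_apply',
      prodMap₂_tmul, Basis.piTensorProduct_apply, Basis.piTensorProduct_apply, prodMap_tprod,
      prodMap_tprod]
    simp only [Module.Basis.map_apply, LinearEquiv.apply_symm_apply, coe_basisMonomials,
      rename_monomial, ← monomial_sum_one, monomial_mul, one_mul]
    refine congrArg (fun d => monomial d (1 : ℂ)) (Finsupp.ext ?_)
    rintro ⟨i | j, r⟩
    · rw [Finsupp.add_apply, Finsupp.finsetSum_apply, Finsupp.finsetSum_apply,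
        Finset.sum_eq_single i, Finset.sum_eq_zero, add_zero,
        Finsupp.mapDomain_apply (Prod.mk_right_injective _)]
      · simp [exponentEquiv]
      · intro l _
        exact Finsupp.mapDomain_of_notMem_range _ _ (by simp)
      · intro l _ hl
        exact Finsupp.mapDomain_of_notMem_range _ _ (by simp [hl])
      · simp
    · rw [Finsupp.add_apply, Finsupp.finsetSum_apply, Finsupp.finsetSum_apply,
        Finset.sum_eq_zero, Finset.sum_eq_single j, zero_add,
        Finsupp.mapDomain_apply (Prod.mk_right_injective _)]
      · simp [exponentEquiv]
      · intro l _ hl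
        exact Finsupp.mapDomain_of_notMem_range _ _ (by simp [hl])
      · simp
      · intro l _
        exact Finsupp.mapDomain_of_notMem_range _ _ (by simp)
  rw [this]
  exact E.bijective

/-- The polynomial model of the tensor product of two families of polynomial rings and `V`. -/
noncomputable def modelEquiv (V : Type*) [AddCommGroup V] [Module ℂ V] :
    ((⨂[ℂ] i, M i) ⊗[ℂ] (⨂[ℂ] j, N j)) ⊗[ℂ] V ≃ₗ[ℂ] Poly (ι ⊕ κ) ⊗[ℂ] V :=
  TensorProduct.congr (LinearEquiv.ofBijective (prodMap₂ u w) (prodMap₂_bijective u w))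
    (LinearEquiv.refl ℂ V)

theorem modelEquiv_tmul (V : Type*) [AddCommGroup V] [Module ℂ V] (x : ⨂[ℂ] i, M i)
    (y : ⨂[ℂ] j, N j) (v : V) :
    modelEquiv u w V ((x ⊗ₜ y) ⊗ₜ v) =
      (prodMap u Sum.inl x * prodMap w Sum.inr y) ⊗ₜ v := by
  rw [← prodMap₂_tmul]; rfl

omit [Fintype ι] [Fintype κ] in
theorem linearMap_ext_tprod {V P : Type*} [AddCommGroup V] [Module ℂ V] [AddCommGroup P]
    [Module ℂ P] {F G : ((⨂[ℂ] i, M i) ⊗[ℂ] (⨂[ℂ] j, N j)) ⊗[ℂ] V →ₗ[ℂ] P}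
    (h : ∀ (m : ∀ i, M i) (n : ∀ j, N j) (v : V),
      F ((PiTensorProduct.tprod ℂ m ⊗ₜ PiTensorProduct.tprod ℂ n) ⊗ₜ v) =
        G ((PiTensorProduct.tprod ℂ m ⊗ₜ PiTensorProduct.tprod ℂ n) ⊗ₜ v)) : F = G := by
  apply TensorProduct.ext
  apply TensorProduct.ext
  refine PiTensorProduct.ext (MultilinearMap.ext fun m => ?_)
  refine PiTensorProduct.ext (MultilinearMap.ext fun n => ?_)
  exact LinearMap.ext fun v => h m n v

variable [DecidableEq ι] [DecidableEq κ]
  [∀ i, LieRingModule Alg (M i)] [∀ i, LieModule ℂ Alg (M i)]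
  [∀ i, LieRingModule Alg (N i)] [∀ i, LieModule ℂ Alg (N i)]
  {V : Type*} [AddCommGroup V] [Module ℂ V] [LieRingModule Alg V] [LieModule ℂ Alg V]
  {c : ι ⊕ κ → FactorParam} {u w}

theorem modelEquiv_lie (hu : ∀ i, IsModelFactor c (Sum.inl i) (u i))
    (hw : ∀ j, IsModelFactor c (Sum.inr j) (w j)) (a : Idx)
    (t : ((⨂[ℂ] i, M i) ⊗[ℂ] (⨂[ℂ] j, N j)) ⊗[ℂ] V) :
    modelEquiv u w V ⁅basis a, t⁆ = totalOp c V a (modelEquiv u w V t) := by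
  have pure : ∀ (m : ∀ i, M i) (n : ∀ j, N j) (v : V),
      modelEquiv u w V ⁅basis a, (PiTensorProduct.tprod ℂ m ⊗ₜ[ℂ] PiTensorProduct.tprod ℂ n) ⊗ₜ v⁆ =
        totalOp c V a (modelEquiv u w V
          ((PiTensorProduct.tprod ℂ m ⊗ₜ PiTensorProduct.tprod ℂ n) ⊗ₜ v)) := by
    intro m n v
    simp only [TensorProduct.LieModule.lie_tmul_right, PiTensorLie.lie_tprod, map_add,
      TensorProduct.add_tmul, TensorProduct.sum_tmul, TensorProduct.tmul_sum, map_sum,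
      modelEquiv_tmul, totalOp_tmul, Fintype.sum_sum_type]
    congr 2
    · refine Finset.sum_congr rfl fun i _ => ?_
      rw [factorOp_prodMap Sum.inl_injective (hu i) a m (isFree_prodMap (by simp) n)]
    · refine Finset.sum_congr rfl fun i _ => ?_
      rw [mul_comm (prodMap u _ _), mul_comm (prodMap u _ _),
        factorOp_prodMap Sum.inr_injective (hw i) a n (isFree_prodMap (by simp) m)]
  exact LinearMap.congr_fun (linearMap_ext_tprod (F := (modelEquiv u w V).toLinearMap ∘ₗ
    LieModule.toEnd ℂ Alg (((⨂[ℂ] i, M i) ⊗[ℂ] (⨂[ℂ] j, N j)) ⊗[ℂ] V) (basis a))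
    (G := totalOp c V a ∘ₗ (modelEquiv u w V).toLinearMap) pure) t

end Combined

end PGCA

namespace PGCA

/-- The parameters of the tensor factors of `T`. -/
def factorParams (m₁ m₂ : ℕ) (lam sig : Fin (m₁ + m₂) → ℂˣ) (eta : Fin (m₁ + m₂) → ℂ) :
    Fin m₁ ⊕ Fin m₂ → FactorParam :=
  Sum.elim
    (fun k => ⟨true, lam (Fin.castAdd m₂ k), sig (Fin.castAdd m₂ k), eta (Fin.castAdd m₂ k)⟩)
    (fun k => ⟨false, lam (Fin.natAdd m₁ k), sig (Fin.natAdd m₁ k), eta (Fin.natAdd m₁ k)⟩)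

/-! ### Parameter sets and their cardinalities -/

section Params

variable {m₁ m₂ : ℕ} {lam sig : Fin (m₁ + m₂) → ℂˣ} {eta : Fin (m₁ + m₂) → ℂ}

theorem mem_omegaParams_iff (x : ℂˣ × ℂˣ × ℂ) : x ∈ omegaParams m₁ m₂ lam sig eta ↔
    (⟨true, x.1, x.2.1, x.2.2⟩ : FactorParam) ∈ Set.range (factorParams m₁ m₂ lam sig eta) := by
  obtain ⟨a, b, e⟩ := x
  simp [omegaParams, factorParams]

theorem mem_gammaParams_iff (x : ℂˣ × ℂˣ × ℂ) : x ∈ gammaParams m₁ m₂ lam sig eta ↔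
    (⟨false, x.1, x.2.1, x.2.2⟩ : FactorParam) ∈ Set.range (factorParams m₁ m₂ lam sig eta) := by
  obtain ⟨a, b, e⟩ := x
  simp [gammaParams, factorParams]

variable {n₁ n₂ : ℕ} {mu tau : Fin (n₁ + n₂) → ℂˣ} {gam : Fin (n₁ + n₂) → ℂ}

theorem range_factorParams_eq_iff :
    Set.range (factorParams m₁ m₂ lam sig eta) = Set.range (factorParams n₁ n₂ mu tau gam) ↔
      omegaParams m₁ m₂ lam sig eta = omegaParams n₁ n₂ mu tau gam ∧
        gammaParams m₁ m₂ lam sig eta = gammaParams n₁ n₂ mu tau gam := by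
  refine ⟨fun h => ⟨?_, ?_⟩, fun ⟨h₁, h₂⟩ => ?_⟩
  · ext x; rw [mem_omegaParams_iff, mem_omegaParams_iff, h]
  · ext x; rw [mem_gammaParams_iff, mem_gammaParams_iff, h]
  · ext ⟨_ | _, a, b, e⟩
    · have := Set.ext_iff.1 h₂ (a, b, e)
      rwa [mem_gammaParams_iff, mem_gammaParams_iff] at this
    · have := Set.ext_iff.1 h₁ (a, b, e)
      rwa [mem_omegaParams_iff, mem_omegaParams_iff] at this

/-- Distinct first parameters exclude repeated triples, so the set, not just the family, remembers
the number of factors. -/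
theorem card_omegaParams (h : Function.Injective fun k => (factorParams m₁ m₂ lam sig eta k).lam) :
    Nat.card (omegaParams m₁ m₂ lam sig eta) = m₁ := by
  rw [omegaParams, Nat.card_range_of_injective, Nat.card_eq_fintype_card, Fintype.card_fin]
  intro k l hkl
  exact Sum.inl_injective (h (congrArg Prod.fst hkl))

theorem card_gammaParams (h : Function.Injective fun k => (factorParams m₁ m₂ lam sig eta k).lam) :
    Nat.card (gammaParams m₁ m₂ lam sig eta) = m₂ := by
  rw [gammaParams, Nat.card_range_of_injective, Nat.card_eq_fintype_card, Fintype.card_fin]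
  intro k l hkl
  exact Sum.inr_injective (h (congrArg Prod.fst hkl))

end Params

/-! ### Transporting submodules and isomorphisms to the model -/

section Model

variable (m₁ m₂ : ℕ) (lam sig : Fin (m₁ + m₂) → ℂˣ) (eta : Fin (m₁ + m₂) → ℂ)
  (V : Type*) [AddCommGroup V] [Module ℂ V] [LieRingModule Alg V] [LieModule ℂ Alg V]

/-- The polynomial model of `T`. -/
noncomputable def T.model : T m₁ m₂ lam sig eta V ≃ₗ[ℂ] Poly (Fin m₁ ⊕ Fin m₂) ⊗[ℂ] V :=
  modelEquiv (fun _ => Omega.toPoly _ _ _) (fun _ => Gamma.toPoly _ _ _) V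

variable {m₁ m₂ lam sig eta V}

theorem T.model_lie (a : Idx) (t : T m₁ m₂ lam sig eta V) :
    T.model m₁ m₂ lam sig eta V ⁅basis a, t⁆ =
      totalOp (factorParams m₁ m₂ lam sig eta) V a (T.model m₁ m₂ lam sig eta V t) :=
  modelEquiv_lie (fun _ => isModelFactor_omega rfl) (fun _ => isModelFactor_gamma rfl) a t

theorem lam_injective_of_isIrreducible [Nontrivial V]
    [LieModule.IsIrreducible ℂ Alg (T m₁ m₂ lam sig eta V)] :
    Function.Injective fun k => (factorParams m₁ m₂ lam sig eta k).lam := by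
  refine lam_injective_of_invariant (V := V) _ fun N hN => ?_
  let e := T.model m₁ m₂ lam sig eta V
  -- Invariance under the basis operators extends linearly to the whole algebra, so the preimage of
  -- `N` is a submodule of the simple module `T`.
  let N' : LieSubmodule ℂ Alg (T m₁ m₂ lam sig eta V) :=
    { N.comap e.toLinearMap with
      lie_mem := by
        intro x t ht
        change t ∈ N.comap e.toLinearMap at ht
        change ⁅x, t⁆ ∈ N.comap e.toLinearMap
        induction x using basis_induction with
        | zero => rw [zero_lie]; exact Submodule.zero_mem _
        | add x y hx hy => rw [add_lie]; exact Submodule.add_mem _ hx hy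
        | smul r x hx => rw [smul_lie]; exact Submodule.smul_mem _ _ hx
        | single a =>
          rw [Submodule.mem_comap, LinearEquiv.coe_coe, T.model_lie]
          exact hN a _ ht }
  have hN' : ∀ w, w ∈ N ↔ e.symm w ∈ N' := by
    intro w
    change _ ↔ e (e.symm w) ∈ N
    rw [e.apply_symm_apply]
  rcases eq_bot_or_eq_top N' with h | h
  · left
    ext w
    rw [hN', h, LieSubmodule.mem_bot, Submodule.mem_bot, LinearEquiv.map_eq_zero_iff]
  · right
    ext w
    rw [hN', h]
    simp

variable {n₁ n₂ : ℕ} {mu tau : Fin (n₁ + n₂) → ℂˣ} {gam : Fin (n₁ + n₂) → ℂ}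
  {W : Type*} [AddCommGroup W] [Module ℂ W] [LieRingModule Alg W] [LieModule ℂ Alg W]

theorem nonempty_equiv_T_iff : Nonempty (T m₁ m₂ lam sig eta V ≃ₗ⁅ℂ, Alg⁆ T n₁ n₂ mu tau gam W) ↔
    ∃ Φ : Poly (Fin m₁ ⊕ Fin m₂) ⊗[ℂ] V ≃ₗ[ℂ] Poly (Fin n₁ ⊕ Fin n₂) ⊗[ℂ] W,
      ∀ a w, Φ (totalOp (factorParams m₁ m₂ lam sig eta) V a w) =
        totalOp (factorParams n₁ n₂ mu tau gam) W a (Φ w) := by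
  let e := T.model m₁ m₂ lam sig eta V
  let e' := T.model n₁ n₂ mu tau gam W
  constructor
  · rintro ⟨φ⟩
    refine ⟨e.symm ≪≫ₗ φ.toLinearEquiv ≪≫ₗ e', fun a w => ?_⟩
    obtain ⟨t, rfl⟩ := e.surjective w
    rw [← T.model_lie]
    simp only [LinearEquiv.trans_apply, e, LinearEquiv.symm_apply_apply]
    rw [← T.model_lie]
    exact congrArg e' (LieModuleHom.map_lie φ.toLieModuleHom _ _)
  · rintro ⟨Φ, hΦ⟩
    let φ := e ≪≫ₗ Φ ≪≫ₗ e'.symm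
    refine ⟨{ φ with map_lie' := ?_ }⟩
    intro x t
    change φ ⁅x, t⁆ = ⁅x, φ t⁆
    induction x using basis_induction with
    | zero => rw [zero_lie, zero_lie, map_zero]
    | add x y hx hy => rw [add_lie, add_lie, map_add, hx, hy]
    | smul r x hx => rw [smul_lie, smul_lie, map_smul, hx]
    | single a =>
      apply e'.injective
      rw [T.model_lie]
      simp only [φ, e, LinearEquiv.trans_apply, T.model_lie, hΦ]
      rw [e'.apply_symm_apply, e'.apply_symm_apply]

end Model

end PGCA

/-! ### The isomorphism criterion -/

theorem theorem3p5
    {m₁ m₂ : ℕ} (lam sig : Fin (m₁ + m₂) → ℂˣ) (eta : Fin (m₁ + m₂) → ℂ)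
    {n₁ n₂ : ℕ} (mu tau : Fin (n₁ + n₂) → ℂˣ) (gam : Fin (n₁ + n₂) → ℂ)
    {V : Type*} [AddCommGroup V] [Module ℂ V] [LieRingModule PGCA.Alg V]
    [LieModule ℂ PGCA.Alg V]
    (hV : LieModule.IsIrreducible ℂ PGCA.Alg V) (hV' : PGCA.IsRestricted V)
    {W : Type*} [AddCommGroup W] [Module ℂ W] [LieRingModule PGCA.Alg W]
    [LieModule ℂ PGCA.Alg W]
    (hW : LieModule.IsIrreducible ℂ PGCA.Alg W) (hW' : PGCA.IsRestricted W)
    (hTV : LieModule.IsIrreducible ℂ PGCA.Alg (PGCA.T m₁ m₂ lam sig eta V))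
    (hTW : LieModule.IsIrreducible ℂ PGCA.Alg (PGCA.T n₁ n₂ mu tau gam W)) :
    Nonempty (PGCA.T m₁ m₂ lam sig eta V ≃ₗ⁅ℂ, PGCA.Alg⁆ PGCA.T n₁ n₂ mu tau gam W) ↔
      ((m₁, m₂) = (n₁, n₂) ∧
        Nonempty (V ≃ₗ⁅ℂ, PGCA.Alg⁆ W) ∧
        PGCA.omegaParams m₁ m₂ lam sig eta = PGCA.omegaParams n₁ n₂ mu tau gam ∧
        PGCA.gammaParams m₁ m₂ lam sig eta = PGCA.gammaParams n₁ n₂ mu tau gam) := by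
  have : Nontrivial V := (LieSubmodule.nontrivial_iff ℂ PGCA.Alg V).1 inferInstance
  have : Nontrivial W := (LieSubmodule.nontrivial_iff ℂ PGCA.Alg W).1 inferInstance
  have hc := PGCA.lam_injective_of_isIrreducible (lam := lam) (sig := sig) (eta := eta) (V := V)
  have hc' := PGCA.lam_injective_of_isIrreducible (lam := mu) (sig := tau) (eta := gam) (V := W)
  rw [PGCA.nonempty_equiv_T_iff]
  constructor
  · rintro ⟨Φ, hΦ⟩
    obtain ⟨⟨π, hπ⟩, hVW⟩ := PGCA.exists_equiv_of_iso hV' hW' Φ hΦ hc hc'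
    have hrange : Set.range (PGCA.factorParams m₁ m₂ lam sig eta) =
        Set.range (PGCA.factorParams n₁ n₂ mu tau gam) := by
      rw [← π.surjective.range_comp (PGCA.factorParams n₁ n₂ mu tau gam)]
      exact congrArg Set.range (funext fun k => (hπ k).symm)
    obtain ⟨h₁, h₂⟩ := PGCA.range_factorParams_eq_iff.1 hrange
    refine ⟨?_, hVW, h₁, h₂⟩
    have e₁ := PGCA.card_omegaParams hc
    have e₂ := PGCA.card_gammaParams hc
    rw [h₁, PGCA.card_omegaParams hc'] at e₁
    rw [h₂, PGCA.card_gammaParams hc'] at e₂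
    exact Prod.ext e₁.symm e₂.symm
  · rintro ⟨-, ⟨ψ⟩, h₁, h₂⟩
    have hrange := PGCA.range_factorParams_eq_iff.2 ⟨h₁, h₂⟩
    -- Both parameter families are injective because their first components are, so equal ranges
    -- give a bijection of the index sets.
    have hinj : Function.Injective (PGCA.factorParams m₁ m₂ lam sig eta) :=
      Function.Injective.of_comp (f := PGCA.FactorParam.lam) hc
    have hinj' : Function.Injective (PGCA.factorParams n₁ n₂ mu tau gam) :=
      Function.Injective.of_comp (f := PGCA.FactorParam.lam) hc'
    refine PGCA.exists_iso_of_equiv ((Equiv.ofInjective _ hinj).trans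
      ((Equiv.setCongr hrange).trans (Equiv.ofInjective _ hinj').symm)) (fun k => ?_) ψ
    exact Equiv.apply_ofInjective_symm hinj' _
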